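/- Let $(M,d)$ be a complete metric space and $\mathbf m$ a Radon measure on $M$ that is finite on bounded sets. For a Lipschitz function $f:M\to\mathbb R$ let $\operatorname{lip} f(x)=\limsup_{y\to x,\,y\ne x}\frac{|f(y)-f(x)|}{d(y,x)}$ (equal to $0$ at isolated points). For $p\in(1,\infty)$ let $D_p^{\operatorname{lip}}$ be the set of Lipschitz functions $f$ with $\operatorname{lip} f\in L^p(\mathbf m)$, and let $D_p\subset L^0(\mathbf m)$ be the set of those $f$ for which $$\inf\Big\{\liminf_{n\to\infty}\int(\operatorname{lip} f_n)^p\,d\mathbf m \;:\; f_n\in D_p^{\operatorname{lip}},\ f_n\to f \text{ in } L^0(\mathbf m)\Big\}<\infty ,$$ where convergence in $L^0(\mathbf m)$ is convergence in measure on sets of finite measure. For $f\in D_p$ the relaxed slope $|Df|_{*,p}\in L^p(\mathbf m)$ is the ($\mathbf m$-a.e.) greatest $G\in L^p(\mathbf m)$ such that $G\le \tilde G$ $\mathbf m$-a.e. whenever $f_n\in D_p^{\operatorname{lip}}$, $f_n\to f$ in $L^0(\mathbf m)$ and $\operatorname{lip} f_n\rightharpoonup\tilde G$ weakly in $L^p(\mathbf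 m)$. It is subadditive and absolutely homogeneous on the linear space $D_p$. The $L^p$-cotangent module $L^p(T^*M)$ is the Banach space obtained as the completion, after dividing out the elements of norm $0$, of the space of all families $s=(f_i,A_i)_{i\in\mathbb N}$ with $(A_i)$ a Borel partition of $M$, $f_i\in D_p$ and $\|s\|^p=\sum_i\int_{A_i}|Df_i|_{*,p}^p\,d\mathbf m<\infty$, with the vector space operations taken pointwise on common refinements of the partitions. The Cheeger energy is $E(f)=\int|Df|_{*,2}^2\,d\mathbf m$ for $f\in D_2$ and $E(f)=\infty$ for $f\in L^0(\mathbf m)\setminus D_2$. **Proposition.** Suppose that $(M,d,\mathbf m)$ is infinitesimally Riemannian, i.e. for all Lipschitz functions $f,g:M\to\mathbb R$ $$(\operatorname{lip}(f+g))^2+(\operatorname{lip}(f-g))^2=2(\operatorname{lip} f)^2+2(\operatorname{lip} g)^2\qquad \mathbf m\text{-a.e.}$$ Then $(M,d,\mathbf m)$ is infinitesimally Hilbertian, i.e. the Cheeger energy is a quadratic form: $E(f+g)+E(f-g)=2E(f)+2E(g)$ and $E(cf)=c^2E(f)$ for all $f,g\in L^0(\mathbf m)$, $c\in\mathbb R$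 (with $0\cdot\infty=0$). Moreover, $L^p(T^*M)$ is reflexive for every $p\in(1,\infty)$. -/

import Mathlib

open MeasureTheory Filter Topology Set
open scoped ENNReal NNReal

noncomputable section

namespace MetricSobolev

/-! ### The local Lipschitz constant -/

section Lip

variable {M : Type*} [MetricSpace M]

/-- The local Lipschitz constant (slope) of `f` at `x`, that is the upper limit of
`|f y - f x| / d(y, x)` as `y → x` with `y ≠ x`; it is `0` at isolated points. -/
def lip (f : M → ℝ) (x : M) : ℝ :=
  limsup (fun y => |f y - f x| / dist y x) (𝓝[≠] x)

/-- `f` is a (globally) Lipschitz function. -/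
def IsLip (f : M → ℝ) : Prop := ∃ K : ℝ≥0, LipschitzWith K f

theorem IsLip.add {f g : M → ℝ} (hf : IsLip f) (hg : IsLip g) : IsLip (f + g) := by
  obtain ⟨K, hK⟩ := hf
  obtain ⟨L, hL⟩ := hg
  exact ⟨K + L, hK.add hL⟩

theorem IsLip.smul {f : M → ℝ} (hf : IsLip f) (c : ℝ) : IsLip (c • f) := by
  obtain ⟨K, hK⟩ := hf
  refine ⟨‖c‖₊ * K, LipschitzWith.of_dist_le_mul fun x y => ?_⟩
  have := hK.dist_le_mul x y
  simp only [Pi.smul_apply, dist_smul₀, NNReal.coe_mul, coe_nnnorm, mul_assoc]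
  gcongr

theorem IsLip.continuous {f : M → ℝ} (hf : IsLip f) : Continuous f :=
  hf.choose_spec.continuous

theorem IsLip.bdd {f : M → ℝ} (hf : IsLip f) (x : M) :
    (𝓝[≠] x).IsBoundedUnder (· ≤ ·) (fun y => |f y - f x| / dist y x) := by
  obtain ⟨K, hK⟩ := hf
  refine isBoundedUnder_of ⟨K, fun y => ?_⟩
  have := hK.dist_le_mul y x
  rw [Real.dist_eq] at this
  exact div_le_of_le_mul₀ dist_nonneg K.2 this

theorem lip_of_bot (f : M → ℝ) {x : M} (h : 𝓝[≠] x = ⊥) : lip f x = 0 := by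
  simp [lip, h, limsup, limsSup]

theorem IsLip.eventually_lt {f : M → ℝ} (hf : IsLip f) {x : M} {c : ℝ} (h : lip f x < c) :
    ∀ᶠ y in 𝓝[≠] x, |f y - f x| / dist y x < c :=
  eventually_lt_of_limsup_lt h (hf.bdd x)

theorem lip_le_of_eventually {f : M → ℝ} {x : M} {c : ℝ} (hc : 0 ≤ c)
    (h : ∀ᶠ y in 𝓝[≠] x, |f y - f x| / dist y x ≤ c) : lip f x ≤ c := by
  rcases eq_or_neBot (𝓝[≠] x) with hb | hb
  · rwa [lip_of_bot f hb]
  · refine limsup_le_of_le ?_ h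
    exact IsCoboundedUnder.of_frequently_ge (a := 0)
      (Eventually.frequently (Eventually.of_forall fun y => by positivity))

theorem IsLip.lip_nonneg {f : M → ℝ} (hf : IsLip f) (x : M) : 0 ≤ lip f x := by
  rcases eq_or_neBot (𝓝[≠] x) with hb | hb
  · rw [lip_of_bot f hb]
  · refine le_limsup_of_frequently_le (Eventually.frequently
      (Eventually.of_forall fun y => by positivity)) (hf.bdd x)

theorem lip_add_le {f g : M → ℝ} (hf : IsLip f) (hg : IsLip g) (x : M) :
    lip (f + g) x ≤ lip f x + lip g x := by
  refine le_of_forall_pos_le_add fun ε hε => ?_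
  have h1 := hf.eventually_lt (x := x) (c := lip f x + ε / 2) (by linarith)
  have h2 := hg.eventually_lt (x := x) (c := lip g x + ε / 2) (by linarith)
  have h3 := hf.lip_nonneg x
  have h4 := hg.lip_nonneg x
  refine lip_le_of_eventually (by linarith) ?_
  filter_upwards [h1, h2] with y hy1 hy2
  have : |(f + g) y - (f + g) x| / dist y x
      ≤ |f y - f x| / dist y x + |g y - g x| / dist y x := by
    rw [← add_div]
    gcongr
    simp only [Pi.add_apply]
    rw [add_sub_add_comm]
    exact abs_add_le _ _
  linarith

theorem lip_smul_le {f : M → ℝ} (hf : IsLip f) (c : ℝ) (x : M) :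
    lip (c • f) x ≤ |c| * lip f x := by
  have h3 := hf.lip_nonneg x
  have key : ∀ ε > 0, lip (c • f) x ≤ |c| * (lip f x + ε) := by
    intro ε hε
    refine lip_le_of_eventually (by positivity) ?_
    filter_upwards [hf.eventually_lt (x := x) (c := lip f x + ε) (by linarith)] with y hy
    have : |(c • f) y - (c • f) x| / dist y x = |c| * (|f y - f x| / dist y x) := by
      simp only [Pi.smul_apply, smul_eq_mul, ← mul_sub, abs_mul, mul_div_assoc]
    rw [this]
    gcongr
  have ht : Tendsto (fun ε : ℝ => |c| * (lip f x + ε)) (𝓝[>] 0) (𝓝 (|c| * (lip f x + 0))) :=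
    Tendsto.mono_left (Continuous.tendsto (by fun_prop) 0) nhdsWithin_le_nhds
  rw [add_zero] at ht
  exact ge_of_tendsto ht (eventually_mem_nhdsWithin.mono fun ε hε => key ε hε)

theorem lip_smul {f : M → ℝ} (hf : IsLip f) (c : ℝ) (x : M) :
    lip (c • f) x = |c| * lip f x := by
  refine le_antisymm (lip_smul_le hf c x) ?_
  rcases eq_or_ne c 0 with rfl | hc
  · simpa using (hf.smul 0).lip_nonneg x
  · have := lip_smul_le (hf.smul c) c⁻¹ x
    rw [smul_smul, inv_mul_cancel₀ hc, one_smul, abs_inv] at this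
    rwa [inv_mul_eq_div, le_div_iff₀' (abs_pos.2 hc)] at this

theorem IsLip.measurable_lip [MeasurableSpace M] [BorelSpace M] {f : M → ℝ} (hf : IsLip f) :
    Measurable (lip f) := by
  refine measurable_of_Iio fun a => ?_
  have : lip f ⁻¹' Iio a = ⋃ b : ℚ, ⋃ (_ : (b : ℝ) < a ∧ 0 ≤ (b : ℝ)), ⋃ n : ℕ,
      ⋂ y : M, {x | 1 / ((n : ℝ) + 1) ≤ dist y x} ∪ {x | |f y - f x| ≤ b * dist y x} := by
    ext x
    simp only [mem_preimage, mem_Iio, mem_iUnion, mem_iInter, mem_union, mem_ofPred_eq,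
      exists_prop]
    constructor
    · intro hx
      obtain ⟨b, hb1, hb2⟩ := exists_rat_btwn hx
      refine ⟨b, ⟨hb2, (hf.lip_nonneg x).trans hb1.le⟩, ?_⟩
      have h := hf.eventually_lt hb1
      rw [eventually_nhdsWithin_iff, Metric.eventually_nhds_iff] at h
      obtain ⟨ε, hε, h⟩ := h
      obtain ⟨n, hn⟩ := exists_nat_one_div_lt hε
      refine ⟨n, fun y => ?_⟩
      by_cases hy : dist y x < ε
      · right
        by_cases hyx : y = x
        · simp [hyx]
        · have h2 := h hy hyx
          rw [div_lt_iff₀ (dist_pos.2 hyx)] at h2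
          exact h2.le
      · left; linarith
    · rintro ⟨b, ⟨hb, hb0⟩, n, h⟩
      refine lt_of_le_of_lt (lip_le_of_eventually hb0 ?_) hb
      rw [eventually_nhdsWithin_iff, Metric.eventually_nhds_iff]
      refine ⟨1 / ((n : ℝ) + 1), by positivity, fun y hy hyx => ?_⟩
      rcases h y with h | h
      · linarith
      · exact div_le_of_le_mul₀ dist_nonneg hb0 h
  rw [this]
  have hfc := hf.continuous
  refine MeasurableSet.iUnion fun b => MeasurableSet.iUnion fun _ => MeasurableSet.iUnion fun n =>
    (isClosed_iInter fun y => IsClosed.union ?_ ?_).measurableSet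
  · exact isClosed_le continuous_const (by fun_prop)
  · exact isClosed_le (by fun_prop) (by fun_prop)

end Lip
section LpFacts

variable {M : Type*} [MeasurableSpace M] {m : Measure M} {p : ℝ≥0∞}

instance fact_one_le [h : Fact (1 < p)] : Fact (1 ≤ p) := ⟨h.out.le⟩

instance fact_one_lt_two : Fact ((1 : ℝ≥0∞) < 2) := ⟨ENNReal.one_lt_two⟩

instance fact_two_lt_top : Fact ((2 : ℝ≥0∞) < ⊤) := ⟨ENNReal.ofNat_lt_top⟩

theorem one_lt_toReal [h1 : Fact (1 < p)] [h2 : Fact (p < ⊤)] : 1 < p.toReal := by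
  have := (ENNReal.toReal_lt_toReal ENNReal.one_ne_top h2.out.ne).2 h1.out
  simpa using this

theorem Lp_smul_nonneg {c : ℝ} (hc : 0 ≤ c) {a : Lp ℝ p m} (h : 0 ≤ a) : 0 ≤ c • a := by
  rw [← Lp.coeFn_nonneg] at h ⊢
  filter_upwards [h, Lp.coeFn_smul c a] with x hx h1
  rw [h1]
  exact mul_nonneg hc hx

theorem Lp_smul_le {c : ℝ} (hc : 0 ≤ c) {a b : Lp ℝ p m} (h : a ≤ b) : c • a ≤ c • b := by
  rw [← sub_nonneg, ← smul_sub]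
  exact Lp_smul_nonneg hc (sub_nonneg.2 h)

variable [h1 : Fact (1 < p)] [h2 : Fact (p < ⊤)]

theorem Lp_norm_rpow (a : Lp ℝ p m) :
    ‖a‖ ^ p.toReal = ∫ x, ‖a x‖ ^ p.toReal ∂m := by
  have hq := one_lt_toReal (p := p)
  have hp0 : p ≠ 0 := (zero_lt_one.trans h1.out).ne'
  have h0 : 0 ≤ ∫ x, ‖a x‖ ^ p.toReal ∂m := integral_nonneg fun x => by positivity
  rw [Lp.norm_def, (Lp.memLp a).eLpNorm_eq_integral_rpow_norm hp0 h2.out.ne,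
    ENNReal.toReal_ofReal (by positivity), Real.rpow_inv_rpow h0 (by linarith)]

theorem Lp_integrable (a : Lp ℝ p m) : Integrable (fun x => ‖a x‖ ^ p.toReal) m :=
  (Lp.memLp a).integrable_norm_rpow (zero_lt_one.trans h1.out).ne' h2.out.ne

theorem Lp_mono_rpow {a b : Lp ℝ p m} (ha : 0 ≤ a) (hab : a ≤ b) :
    ‖b - a‖ ^ p.toReal + ‖a‖ ^ p.toReal ≤ ‖b‖ ^ p.toReal := by
  have hq := one_lt_toReal (p := p)
  rw [Lp_norm_rpow, Lp_norm_rpow, Lp_norm_rpow, ← integral_add (Lp_integrable _) (Lp_integrable _)]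
  refine integral_mono_ae ((Lp_integrable _).add (Lp_integrable _)) (Lp_integrable _) ?_
  filter_upwards [(Lp.coeFn_nonneg a).2 ha, (Lp.coeFn_le a b).2 hab, Lp.coeFn_sub b a]
    with x hx1 hx2 hx3
  simp only [Pi.zero_apply] at hx1
  simp only [hx3, Pi.sub_apply, Real.norm_of_nonneg hx1,
    Real.norm_of_nonneg (hx1.trans hx2),
    Real.norm_of_nonneg (sub_nonneg.2 hx2)]
  simpa using Real.add_rpow_le_rpow_add (sub_nonneg.2 hx2) hx1 hq.le

theorem uc_pointwise {q : ℝ} (hq : 1 < q) {ε : ℝ} (hε : 0 < ε) :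
    ∃ C > 0, ∀ a b : ℝ, 0 ≤ a → 0 ≤ b →
      |a - b| ^ q ≤ ε * (a ^ q + b ^ q) + C * ((a ^ q + b ^ q) / 2 - ((a + b) / 2) ^ q) := by
  set h : ℝ → ℝ := fun t => (t ^ q + (1 - t) ^ q) / 2 - (1 / 2 : ℝ) ^ q with hh
  have hq0 : 0 ≤ q := by linarith
  have hc : Continuous h := by
    have := Real.continuous_rpow_const hq0
    have h2 : Continuous fun t : ℝ => (1 - t) ^ q := this.comp (by fun_prop)
    fun_prop
  have hc1 : Continuous fun t : ℝ => |t - (1 - t)| ^ q :=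
    (Real.continuous_rpow_const hq0).comp (by fun_prop)
  have hc2 : Continuous fun t : ℝ => ε * (t ^ q + (1 - t) ^ q) := by
    have := Real.continuous_rpow_const hq0
    have h2 : Continuous fun t : ℝ => (1 - t) ^ q := this.comp (by fun_prop)
    fun_prop
  set K : Set ℝ := Icc 0 1 ∩ {t | ε * (t ^ q + (1 - t) ^ q) ≤ |t - (1 - t)| ^ q} with hK
  have hKc : IsCompact K := isCompact_Icc.inter_right (isClosed_le hc2 hc1)
  have hnn : ∀ t ∈ Icc (0 : ℝ) 1, 0 ≤ h t := by
    intro t ht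
    have := (convexOn_rpow hq.le).2 (show t ∈ Ici (0 : ℝ) from ht.1)
      (show 1 - t ∈ Ici (0 : ℝ) by simpa using ht.2) (show (0 : ℝ) ≤ 1 / 2 by norm_num)
      (show (0 : ℝ) ≤ 1 / 2 by norm_num) (by norm_num)
    simp only [smul_eq_mul] at this
    have e : (1 / 2 * t + 1 / 2 * (1 - t) : ℝ) = 1 / 2 := by ring
    rw [e] at this
    simp only [hh]
    linarith
  have hpos : ∀ t ∈ K, 0 < h t := by
    rintro t ⟨ht, ht2⟩
    have hne : t ≠ 1 - t := by
      intro he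
      simp only [mem_ofPred_eq, ← he, sub_self, abs_zero] at ht2
      rw [Real.zero_rpow (by linarith)] at ht2
      have ht0 : 0 < t := by linarith
      have : 0 < t ^ q := Real.rpow_pos_of_pos ht0 q
      nlinarith
    have := (strictConvexOn_rpow hq).2 (show t ∈ Ici (0 : ℝ) from ht.1)
      (show 1 - t ∈ Ici (0 : ℝ) by simpa using ht.2) hne (show (0 : ℝ) < 1 / 2 by norm_num)
      (show (0 : ℝ) < 1 / 2 by norm_num) (by norm_num)
    simp only [smul_eq_mul] at this
    have e : (1 / 2 * t + 1 / 2 * (1 - t) : ℝ) = 1 / 2 := by ring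
    rw [e] at this
    simp only [hh]
    linarith
  obtain ⟨c, hc0, hcK⟩ : ∃ c > 0, ∀ t ∈ K, c ≤ h t := by
    rcases K.eq_empty_or_nonempty with he | hne
    · exact ⟨1, one_pos, by simp [he]⟩
    · obtain ⟨t0, ht0, hmin⟩ := hKc.exists_isMinOn hne hc.continuousOn
      exact ⟨h t0, hpos t0 ht0, fun t ht => hmin ht⟩
  refine ⟨1 / c, by positivity, ?_⟩
  have main : ∀ t ∈ Icc (0 : ℝ) 1,
      |t - (1 - t)| ^ q ≤ ε * (t ^ q + (1 - t) ^ q) + 1 / c * h t := by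
    intro t ht
    have hn1 : 0 ≤ t ^ q := Real.rpow_nonneg ht.1 q
    have hn2 : 0 ≤ (1 - t) ^ q := Real.rpow_nonneg (by linarith [ht.2]) q
    by_cases htK : t ∈ K
    · have h1 : |t - (1 - t)| ^ q ≤ 1 := by
        refine Real.rpow_le_one (abs_nonneg _) ?_ hq0
        rw [abs_le]; constructor <;> linarith [ht.1, ht.2]
      have h2 : 1 ≤ 1 / c * h t := by
        rw [one_div, inv_mul_eq_div, le_div_iff₀ hc0]; linarith [hcK t htK]
      nlinarith
    · have : |t - (1 - t)| ^ q < ε * (t ^ q + (1 - t) ^ q) := by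
        by_contra hcon
        exact htK ⟨ht, not_lt.1 hcon⟩
      have := hnn t ht
      have : 0 ≤ 1 / c * h t := by positivity
      linarith
  intro a b ha hb
  rcases (add_nonneg ha hb).eq_or_lt with h0 | h0
  · have ha0 : a = 0 := by linarith
    have hb0 : b = 0 := by linarith
    simp [ha0, hb0, Real.zero_rpow (by linarith : q ≠ 0)]
  · set s := a + b
    have hm := main (a / s) ⟨by positivity, by rw [div_le_one h0]; simp only [s]; linarith⟩
    have e1 : 1 - a / s = b / s := by field_simp; simp only [s]; ring
    simp only [hh] at hm
    rw [e1, ← sub_div, abs_div, abs_of_pos h0, Real.div_rpow (abs_nonneg _) h0.le,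
      Real.div_rpow ha h0.le, Real.div_rpow hb h0.le, Real.div_rpow zero_le_one (by norm_num)] at hm
    rw [Real.div_rpow h0.le (by norm_num)]
    have hs : 0 < s ^ q := Real.rpow_pos_of_pos h0 q
    have h2' : (0:ℝ) < 2 ^ q := Real.rpow_pos_of_pos (by norm_num) q
    have := mul_le_mul_of_nonneg_left hm hs.le
    rw [Real.one_rpow] at this
    field_simp at this ⊢
    linarith

theorem Lp_uc {ε : ℝ} (hε : 0 < ε) : ∃ C > 0, ∀ a b : Lp ℝ p m, 0 ≤ a → 0 ≤ b →
    ‖a - b‖ ^ p.toReal ≤ ε * (‖a‖ ^ p.toReal + ‖b‖ ^ p.toReal)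
      + C * ((‖a‖ ^ p.toReal + ‖b‖ ^ p.toReal) / 2 - ‖(1 / 2 : ℝ) • (a + b)‖ ^ p.toReal) := by
  obtain ⟨C, hC, hmain⟩ := uc_pointwise (one_lt_toReal (p := p)) hε
  refine ⟨C, hC, fun a b ha hb => ?_⟩
  simp only [Lp_norm_rpow]
  have hab : Integrable (fun x => ‖a x‖ ^ p.toReal + ‖b x‖ ^ p.toReal) m :=
    (Lp_integrable a).add (Lp_integrable b)
  have hI := Lp_integrable ((1 / 2 : ℝ) • (a + b))
  have hJ : Integrable (fun x => (‖a x‖ ^ p.toReal + ‖b x‖ ^ p.toReal) / 2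
      - ‖((1 / 2 : ℝ) • (a + b) : Lp ℝ p m) x‖ ^ p.toReal) m := (hab.div_const 2).sub hI
  have E : ∫ x, (ε * (‖a x‖ ^ p.toReal + ‖b x‖ ^ p.toReal)
      + C * ((‖a x‖ ^ p.toReal + ‖b x‖ ^ p.toReal) / 2
        - ‖((1 / 2 : ℝ) • (a + b) : Lp ℝ p m) x‖ ^ p.toReal)) ∂m
      = ε * (∫ x, ‖a x‖ ^ p.toReal ∂m + ∫ x, ‖b x‖ ^ p.toReal ∂m)
      + C * ((∫ x, ‖a x‖ ^ p.toReal ∂m + ∫ x, ‖b x‖ ^ p.toReal ∂m) / 2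
        - ∫ x, ‖((1 / 2 : ℝ) • (a + b) : Lp ℝ p m) x‖ ^ p.toReal ∂m) := by
    rw [integral_add (hab.const_mul ε) (hJ.const_mul C),
      integral_const_mul, integral_const_mul, integral_sub (hab.div_const 2) hI, integral_div,
      integral_add (Lp_integrable a) (Lp_integrable b)]
  rw [← E]
  refine integral_mono_ae (Lp_integrable _)
    ((hab.const_mul ε).add (hJ.const_mul C)) ?_
  filter_upwards [(Lp.coeFn_nonneg a).2 ha, (Lp.coeFn_nonneg b).2 hb, Lp.coeFn_sub a b,
    Lp.coeFn_smul (1 / 2 : ℝ) (a + b), Lp.coeFn_add a b] with x h1 h2 h3 h4 h5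
  simp only [Pi.zero_apply] at h1 h2
  have := hmain (a x) (b x) h1 h2
  simp only [h3, h4, h5, Pi.sub_apply, Pi.smul_apply, Pi.add_apply, smul_eq_mul]
  have e : (1 / 2 : ℝ) * (a x + b x) = (a x + b x) / 2 := by ring
  rw [e, Real.norm_of_nonneg h1, Real.norm_of_nonneg h2,
    Real.norm_of_nonneg (by linarith : 0 ≤ (a x + b x) / 2), Real.norm_eq_abs]
  exact this

/-- A nonempty set of non-negative elements of `Lp` has a greatest lower bound. -/
theorem exists_greatest_lowerBounds {S : Set (Lp ℝ p m)} (hne : S.Nonempty)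
    (h0 : ∀ G ∈ S, 0 ≤ G) : ∃ G, IsGreatest (lowerBounds S) G := by
  have hq := one_lt_toReal (p := p)
  have hq0 : 0 < p.toReal := by linarith
  obtain ⟨B, hB⟩ := hne
  set L : Set (Lp ℝ p m) := lowerBounds S ∩ Ici 0 with hL
  have hsup : ∀ a ∈ L, ∀ b ∈ lowerBounds S, a ⊔ b ∈ L := fun a ha b hb =>
    ⟨fun G hG => sup_le (ha.1 hG) (hb hG), (show 0 ≤ a from ha.2).trans le_sup_left⟩
  have hbd : ∀ a ∈ L, ‖a‖ ^ p.toReal ≤ ‖B‖ ^ p.toReal := fun a ha => by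
    have := Lp_mono_rpow ha.2 (ha.1 hB)
    have : 0 ≤ ‖B - a‖ ^ p.toReal := by positivity
    linarith
  have hLne : L.Nonempty := ⟨0, fun G hG => h0 G hG, le_refl (0 : Lp ℝ p m)⟩
  set N : Set ℝ := (fun a : Lp ℝ p m => ‖a‖ ^ p.toReal) '' L with hN
  have hNb : BddAbove N := ⟨‖B‖ ^ p.toReal, by rintro _ ⟨a, ha, rfl⟩; exact hbd a ha⟩
  have hNne : N.Nonempty := hLne.image _
  have hex : ∀ n : ℕ, ∃ a ∈ L, sSup N - 1 / ((n : ℝ) + 1) < ‖a‖ ^ p.toReal := by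
    intro n
    obtain ⟨_, ⟨a, ha, rfl⟩, h⟩ := exists_lt_of_lt_csSup hNne
      (show sSup N - 1 / ((n : ℝ) + 1) < sSup N by
        have : (0 : ℝ) < 1 / ((n : ℝ) + 1) := by positivity
        linarith)
    exact ⟨a, ha, h⟩
  choose a haL haN using hex
  -- the increasing sequence of maxima
  set b : ℕ → Lp ℝ p m := fun n => partialSups a n with hb
  have hbL : ∀ n, b n ∈ L := by
    intro n
    induction n with
    | zero => simpa [hb] using haL 0
    | succ n ih =>
      simp only [hb, partialSups_add_one] at ih ⊢
      exact hsup _ ih _ (haL _).1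
  have hmono : Monotone b := (partialSups a).monotone
  have hle : ∀ c ∈ L, ‖c‖ ^ p.toReal ≤ sSup N := fun c hc => le_csSup hNb ⟨c, hc, rfl⟩
  have hge : ∀ n : ℕ, sSup N - 1 / ((n : ℝ) + 1) ≤ ‖b n‖ ^ p.toReal := by
    intro n
    have h1 : a n ≤ b n := le_partialSups a n
    have := Lp_mono_rpow (haL n).2 h1
    have : 0 ≤ ‖b n - a n‖ ^ p.toReal := by positivity
    linarith [haN n]
  have hgap : ∀ n : ℕ, ∀ c ∈ L, b n ≤ c → ‖c - b n‖ ^ p.toReal ≤ 1 / ((n : ℝ) + 1) := by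
    intro n c hc hbc
    have := Lp_mono_rpow (hbL n).2 hbc
    linarith [hge n, hle c hc]
  have hcau : CauchySeq b := by
    rw [Metric.cauchySeq_iff']
    intro ε hε
    obtain ⟨n, hn⟩ := exists_nat_one_div_lt (Real.rpow_pos_of_pos hε p.toReal)
    refine ⟨n, fun k hk => ?_⟩
    rw [dist_eq_norm]
    exact (Real.rpow_lt_rpow_iff (norm_nonneg _) hε.le hq0).1
      ((hgap n _ (hbL k) (hmono hk)).trans_lt hn)
  obtain ⟨G, hG⟩ := cauchySeq_tendsto_of_complete hcau
  have hGL : G ∈ L :=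
    ⟨fun H hH => le_of_tendsto' hG fun n => (hbL n).1 hH, ge_of_tendsto' hG fun n => (hbL n).2⟩
  have hbG : ∀ n, b n ≤ G := fun n =>
    ge_of_tendsto hG (eventually_atTop.2 ⟨n, fun k hk => hmono hk⟩)
  refine ⟨G, hGL.1, fun H hH => ?_⟩
  have hm := hsup G hGL H hH
  have hz : ‖G ⊔ H - G‖ ^ p.toReal ≤ 0 := by
    have h1 := Lp_mono_rpow hGL.2 (le_sup_left : G ≤ G ⊔ H)
    have h3 : sSup N ≤ ‖G‖ ^ p.toReal := by
      have ht : Tendsto (fun n : ℕ => sSup N - 1 / ((n : ℝ) + 1)) atTop (𝓝 (sSup N - 0)) :=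
        tendsto_const_nhds.sub tendsto_one_div_add_atTop_nhds_zero_nat
      rw [sub_zero] at ht
      refine le_of_tendsto' ht fun n => (hge n).trans ?_
      have := Lp_mono_rpow (hbL n).2 (hbG n)
      have : 0 ≤ ‖G - b n‖ ^ p.toReal := by positivity
      linarith
    linarith [hle _ hm]
  have hz0 : ‖G ⊔ H - G‖ = 0 := by
    by_contra hcon
    have : 0 < ‖G ⊔ H - G‖ := lt_of_le_of_ne (norm_nonneg _) (Ne.symm hcon)
    exact absurd (Real.rpow_pos_of_pos this p.toReal) (not_lt.2 hz)
  rw [norm_eq_zero, sub_eq_zero] at hz0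
  rw [← hz0]
  exact le_sup_right

end LpFacts

/-! ### Convergence notions -/

section Convergence

/-- Convergence in `L⁰(m)`: convergence in measure on every set of finite measure. -/
def TendstoL0 {M : Type*} [MeasurableSpace M] (m : Measure M) (u : ℕ → M → ℝ) (f : M → ℝ) :
    Prop :=
  ∀ s : Set M, MeasurableSet s → m s < ⊤ → TendstoInMeasure (m.restrict s) u atTop f

/-- Weak convergence of a sequence in a normed space. -/
def TendstoWeakly {X : Type*} [NormedAddCommGroup X] [NormedSpace ℝ X] (u : ℕ → X) (x : X) :
    Prop :=
  ∀ φ : StrongDual ℝ X, Tendsto (fun n => φ (u n)) atTop (𝓝 (φ x))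

theorem TendstoWeakly.of_tendsto {X : Type*} [NormedAddCommGroup X] [NormedSpace ℝ X]
    {u : ℕ → X} {x : X} (h : Tendsto u atTop (𝓝 x)) : TendstoWeakly u x :=
  fun φ => (φ.continuous.tendsto x).comp h

theorem TendstoWeakly.bdd {X : Type*} [NormedAddCommGroup X] [NormedSpace ℝ X]
    {u : ℕ → X} {x : X} (h : TendstoWeakly u x) : ∃ B, ∀ n, ‖u n‖ ≤ B := by
  obtain ⟨B, hB⟩ := banach_steinhaus
    (g := fun n => NormedSpace.inclusionInDoubleDual ℝ X (u n)) (fun φ => by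
      obtain ⟨C, hC⟩ := (h φ).norm.bddAbove_range
      exact ⟨C, fun n => hC ⟨n, rfl⟩⟩)
  refine ⟨B, fun n => ?_⟩
  have := (NormedSpace.inclusionInDoubleDualLi ℝ (E := X)).norm_map (u n)
  exact this ▸ hB n

variable {M : Type*} [MeasurableSpace M] {m : Measure M}

theorem TendstoWeakly.nonneg {p : ℝ≥0∞} [Fact (1 ≤ p)] {u : ℕ → Lp ℝ p m} {a : Lp ℝ p m}
    (h : TendstoWeakly u a) (hu : ∀ n, 0 ≤ u n) : 0 ≤ a := by
  by_contra hcon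
  have hcone : Convex ℝ {a : Lp ℝ p m | 0 ≤ a} := by
    intro a ha b hb s t hs ht _
    exact add_nonneg (Lp_smul_nonneg hs ha) (Lp_smul_nonneg ht hb)
  obtain ⟨φ, s, hs1, hs2⟩ := geometric_hahn_banach_point_closed hcone
    (isClosed_le continuous_const continuous_id) hcon
  have := ge_of_tendsto' (h φ) fun n => (hs2 _ (hu n)).le
  linarith

theorem TendstoL0.exists_ae [SigmaFinite m] {u : ℕ → M → ℝ} {f : M → ℝ}
    (h : TendstoL0 m u f) :
    ∃ φ : ℕ → ℕ, StrictMono φ ∧ ∀ᵐ x ∂m, Tendsto (fun n => u (φ n) x) atTop (𝓝 (f x)) := by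
  set S := spanningSets m
  have hS : ∀ k, MeasurableSet (S k) := measurableSet_spanningSets m
  have hev : ∀ k : ℕ, ∀ᶠ n in atTop,
      m ({x | (2⁻¹ : ℝ≥0∞) ^ k ≤ edist (u n x) (f x)} ∩ S k) ≤ (2⁻¹ : ℝ≥0∞) ^ k := by
    intro k
    have hpos : (0 : ℝ≥0∞) < 2⁻¹ ^ k := ENNReal.pow_pos (by simp) k
    have := (h (S k) (hS k) (measure_spanningSets_lt_top m k)) _ hpos
    filter_upwards [this.eventually (ge_mem_nhds hpos)] with n hn
    rwa [Measure.restrict_apply' (hS k)] at hn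
  obtain ⟨φ, hφ, hφ2⟩ := extraction_forall_of_eventually hev
  refine ⟨φ, hφ, ?_⟩
  have hsum : ∑' k, m ({x | (2⁻¹ : ℝ≥0∞) ^ k ≤ edist (u (φ k) x) (f x)} ∩ S k) ≠ ⊤ := by
    refine ne_top_of_le_ne_top ?_ (ENNReal.tsum_le_tsum hφ2)
    simp [ENNReal.tsum_geometric, ENNReal.one_sub_inv_two]
  filter_upwards [ae_eventually_notMem hsum] with x hx
  have hxS : ∀ᶠ k in atTop, x ∈ S k := by
    have : x ∈ ⋃ k, S k := by rw [iUnion_spanningSets]; trivial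
    obtain ⟨k0, hk0⟩ := mem_iUnion.1 this
    exact eventually_atTop.2 ⟨k0, fun k hk => monotone_spanningSets m hk hk0⟩
  rw [tendsto_iff_edist_tendsto_0]
  refine tendsto_of_tendsto_of_tendsto_of_le_of_le' tendsto_const_nhds
    (ENNReal.tendsto_pow_atTop_nhds_zero_of_lt_one (r := 2⁻¹) (by simp)) (by simp) ?_
  filter_upwards [hx, hxS] with k hk hkS
  by_contra hcon
  exact hk ⟨(not_le.1 hcon).le, hkS⟩

theorem TendstoL0.of_ae {u : ℕ → M → ℝ} {f : M → ℝ} (hu : ∀ n, AEStronglyMeasurable (u n) m)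
    (h : ∀ᵐ x ∂m, Tendsto (fun n => u n x) atTop (𝓝 (f x))) : TendstoL0 m u f := by
  intro s hs hms
  have : IsFiniteMeasure (m.restrict s) := ⟨by simpa using hms⟩
  exact tendstoInMeasure_of_tendsto_ae (fun n => (hu n).restrict) (ae_restrict_of_ae h)

theorem TendstoL0.comp {u : ℕ → M → ℝ} {f : M → ℝ} (h : TendstoL0 m u f) {φ : ℕ → ℕ}
    (hφ : StrictMono φ) : TendstoL0 m (fun n => u (φ n)) f :=
  fun s hs hms ε hε => (h s hs hms ε hε).comp hφ.tendsto_atTop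

end Convergence

/-! ### Relaxation of the local Lipschitz constant -/

section Relaxation

variable {M : Type*} [MetricSpace M] [MeasurableSpace M] [BorelSpace M]

/-- The Lipschitz functions `f` with `lip f ∈ L^p(m)`. -/
def lipDomain (m : Measure M) (p : ℝ≥0∞) : Submodule ℝ (M → ℝ) where
  carrier := {f | IsLip f ∧ MemLp (lip f) p m}
  add_mem' := by
    rintro f g ⟨hf, hf'⟩ ⟨hg, hg'⟩
    refine ⟨hf.add hg, (hf'.add hg').mono (hf.add hg).measurable_lip.aestronglyMeasurable
      (Eventually.of_forall fun x => ?_)⟩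
    rw [Real.norm_of_nonneg ((hf.add hg).lip_nonneg x), Pi.add_apply,
      Real.norm_of_nonneg (add_nonneg (hf.lip_nonneg x) (hg.lip_nonneg x))]
    exact lip_add_le hf hg x
  zero_mem' := by
    have h0 : IsLip (0 : M → ℝ) := ⟨0, LipschitzWith.const 0⟩
    have : lip (0 : M → ℝ) = 0 := by
      ext x
      simpa using lip_smul h0 0 x
    exact ⟨h0, by rw [this]; exact MemLp.zero⟩
  smul_mem' := by
    rintro c f ⟨hf, hf'⟩
    refine ⟨hf.smul c, ?_⟩
    have : lip (c • f) = |c| • lip f := by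
      ext x
      simpa using lip_smul hf c x
    exact this ▸ hf'.const_smul _

variable {m : Measure M} {p : ℝ≥0∞}

/-- The functional `f ↦ lip f`, with values in `L^p(m)`. -/
def slopeLp (f : lipDomain m p) : Lp ℝ p m := MemLp.toLp (lip (f : M → ℝ)) f.2.2

theorem slopeLp_coe (f : lipDomain m p) : slopeLp f =ᵐ[m] lip (f : M → ℝ) :=
  MemLp.coeFn_toLp _

theorem slopeLp_nonneg (f : lipDomain m p) : 0 ≤ slopeLp f := by
  rw [← Lp.coeFn_nonneg]
  filter_upwards [slopeLp_coe f] with x hx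
  rw [hx]
  exact f.2.1.lip_nonneg x

theorem slopeLp_add_le (f g : lipDomain m p) : slopeLp (f + g) ≤ slopeLp f + slopeLp g := by
  rw [← Lp.coeFn_le]
  filter_upwards [slopeLp_coe f, slopeLp_coe g, slopeLp_coe (f + g),
    Lp.coeFn_add (slopeLp f) (slopeLp g)] with x h1 h2 h3 h4
  rw [h3, h4, Pi.add_apply, h1, h2]
  exact lip_add_le f.2.1 g.2.1 x

theorem slopeLp_smul (c : ℝ) (f : lipDomain m p) : slopeLp (c • f) = |c| • slopeLp f := by
  apply Lp.ext
  filter_upwards [slopeLp_coe f, slopeLp_coe (c • f), Lp.coeFn_smul |c| (slopeLp f)]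
    with x h1 h2 h3
  rw [h2, h3, Pi.smul_apply, h1]
  exact lip_smul f.2.1 c x

theorem lipDomain_aesm (f : lipDomain m p) : AEStronglyMeasurable (f : M → ℝ) m :=
  f.2.1.continuous.aestronglyMeasurable

variable [h1 : Fact (1 < p)]

variable (m p) in
/-- The weak `L^p`-limits of `lip fₙ`, over all sequences `fₙ → f` in `L⁰(m)` of Lipschitz
functions with `lip fₙ ∈ L^p(m)`. -/
def weakSlopeLimits (f : M → ℝ) : Set (Lp ℝ p m) :=
  {G | ∃ u : ℕ → lipDomain m p, TendstoL0 m (fun n => (u n : M → ℝ)) f ∧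
    TendstoWeakly (fun n => slopeLp (u n)) G}

theorem weakSlopeLimits_nonneg {f : M → ℝ} : ∀ G ∈ weakSlopeLimits m p f, 0 ≤ G := by
  rintro G ⟨u, -, hu⟩
  exact hu.nonneg fun n => slopeLp_nonneg _

variable (m p) in
/-- The lower semicontinuous hull in `L⁰(m)` of `f ↦ ∫ (lip f)^p dm`. -/
def lscHull (f : M → ℝ) : ℝ≥0∞ :=
  ⨅ (u : ℕ → lipDomain m p) (_ : TendstoL0 m (fun n => (u n : M → ℝ)) f),
    liminf (fun n => ∫⁻ x, ENNReal.ofReal (lip (u n : M → ℝ) x) ^ p.toReal ∂m) atTop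

variable [h2 : Fact (p < ⊤)]

theorem slopeLp_norm_rpow (u : lipDomain m p) :
    ENNReal.ofReal (‖slopeLp u‖) ^ p.toReal
      = ∫⁻ x, ENNReal.ofReal (lip (u : M → ℝ) x) ^ p.toReal ∂m := by
  have hq := one_lt_toReal (p := p)
  have hp0 : p ≠ 0 := (zero_lt_one.trans h1.out).ne'
  rw [slopeLp, Lp.norm_toLp, ENNReal.ofReal_toReal u.2.2.2.ne,
    eLpNorm_eq_lintegral_rpow_enorm_toReal hp0 h2.out.ne, ← ENNReal.rpow_mul,
    one_div_mul_cancel (by linarith), ENNReal.rpow_one]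
  refine lintegral_congr fun x => ?_
  rw [Real.enorm_eq_ofReal (u.2.1.lip_nonneg x)]

theorem lscHull_lt_top_iff (f : M → ℝ) : lscHull m p f < ⊤ ↔
    ∃ u : ℕ → lipDomain m p, TendstoL0 m (fun n => (u n : M → ℝ)) f ∧
      ∃ B : ℝ, ∀ n, ‖slopeLp (u n)‖ ≤ B := by
  have hq := one_lt_toReal (p := p)
  have hq0 : 0 < p.toReal := by linarith
  simp only [lscHull, iInf_lt_iff, ← slopeLp_norm_rpow]
  constructor
  · rintro ⟨u, hu, hlt⟩
    obtain ⟨c, hc, hc2⟩ := exists_between hlt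
    have hfreq := frequently_lt_of_liminf_lt (by isBoundedDefault) hc
    obtain ⟨φ, hφ, hφ2⟩ := extraction_of_frequently_atTop hfreq
    refine ⟨fun n => u (φ n), hu.comp hφ, (c ^ p.toReal⁻¹).toReal, fun n => ?_⟩
    have h3 := (ENNReal.rpow_le_rpow_iff (inv_pos.2 hq0)).2 (hφ2 n).le
    rw [← ENNReal.rpow_mul, mul_inv_cancel₀ hq0.ne', ENNReal.rpow_one] at h3
    refine (ENNReal.ofReal_le_iff_le_toReal ?_).1 h3
    exact ENNReal.rpow_ne_top_of_nonneg (by positivity) hc2.ne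
  · rintro ⟨u, hu, B, hB⟩
    refine ⟨u, hu, lt_of_le_of_lt (b := ENNReal.ofReal B ^ p.toReal) ?_
      (ENNReal.rpow_lt_top_of_nonneg hq0.le ENNReal.ofReal_ne_top)⟩
    refine liminf_le_of_le (by isBoundedDefault) fun b hb => ?_
    obtain ⟨n, hn⟩ := hb.exists
    exact hn.trans (ENNReal.rpow_le_rpow (ENNReal.ofReal_le_ofReal (hB n)) hq0.le)

/-- Convex combinations of the tails of a sequence with bounded slopes can be chosen such that
their slopes converge strongly in `L^p`. -/
theorem exists_weakSlopeLimit {f : M → ℝ} (u : ℕ → lipDomain m p) (w : ℕ → Lp ℝ p m)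
    (hu : ∀ᵐ x ∂m, Tendsto (fun n => (u n : M → ℝ) x) atTop (𝓝 (f x)))
    (huw : ∀ n, slopeLp (u n) ≤ w n) {B : ℝ} (hB : ∀ n, ‖w n‖ ≤ B) :
    ∃ G ∈ weakSlopeLimits m p f, ∀ H, TendstoWeakly w H → G ≤ H := by
  have hq := one_lt_toReal (p := p)
  have hq0 : 0 < p.toReal := by linarith
  set C : ℕ → Set (lipDomain m p × Lp ℝ p m) := fun n =>
    convexHull ℝ ((fun k => (u k, w k)) '' Ici n) with hC
  have hCconv : ∀ n, Convex ℝ (C n) := fun n => convex_convexHull ℝ _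
  have hCmono : ∀ {n k}, n ≤ k → C k ⊆ C n := fun hnk =>
    convexHull_mono (image_mono (Ici_subset_Ici.2 hnk))
  have hCmem : ∀ n, (u n, w n) ∈ C n := fun n => subset_convexHull ℝ _ ⟨n, self_mem_Ici, rfl⟩
  have hCsub : ∀ {n : ℕ} {T : Set (lipDomain m p × Lp ℝ p m)}, Convex ℝ T →
      (∀ k, n ≤ k → (u k, w k) ∈ T) → C n ⊆ T := by
    intro n T hT h
    refine convexHull_min ?_ hT
    rintro _ ⟨k, hk, rfl⟩
    exact h k hk
  have hslope : ∀ n, ∀ v ∈ C n, slopeLp v.1 ≤ v.2 := by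
    intro n
    refine hCsub (T := {v | slopeLp v.1 ≤ v.2}) ?_ fun k _ => huw k
    intro v hv v' hv' a b ha hb _
    calc slopeLp (a • v.1 + b • v'.1) ≤ slopeLp (a • v.1) + slopeLp (b • v'.1) :=
          slopeLp_add_le _ _
      _ = a • slopeLp v.1 + b • slopeLp v'.1 := by
          rw [slopeLp_smul, slopeLp_smul, abs_of_nonneg ha, abs_of_nonneg hb]
      _ ≤ a • v.2 + b • v'.2 := add_le_add (Lp_smul_le ha hv) (Lp_smul_le hb hv')
  have hbdd : ∀ n, ∀ v ∈ C n, ‖slopeLp v.1‖ ≤ B := by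
    intro n v hv
    have h1 : ‖v.2‖ ≤ B := by
      have hcv : Convex ℝ {v : lipDomain m p × Lp ℝ p m | ‖v.2‖ ≤ B} := by
        have := (convex_closedBall (0 : Lp ℝ p m) B).linear_preimage
          (LinearMap.snd ℝ (lipDomain m p) (Lp ℝ p m))
        simpa [preimage, Metric.mem_closedBall, dist_zero_right] using this
      exact hCsub hcv (fun k _ => hB k) hv
    refine le_trans (norm_le_norm_of_abs_le_abs ?_) h1
    have h0 := slopeLp_nonneg v.1
    rw [abs_of_nonneg h0, abs_of_nonneg (h0.trans (hslope n v hv))]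
    exact hslope n v hv
  -- minimal energies of the tails
  set N : ℕ → Set ℝ := fun n => (fun v => ‖slopeLp v.1‖ ^ p.toReal) '' C n with hN
  have hNne : ∀ n, (N n).Nonempty := fun n => ⟨_, _, hCmem n, rfl⟩
  have hNb : ∀ n, BddBelow (N n) := fun n => ⟨0, by rintro _ ⟨v, _, rfl⟩; positivity⟩
  set I : ℕ → ℝ := fun n => sInf (N n) with hI
  have hImono : Monotone I := fun n k hnk =>
    csInf_le_csInf (hNb n) (hNne k) (image_mono (hCmono hnk))
  have hIle : ∀ n, ∀ v ∈ C n, I n ≤ ‖slopeLp v.1‖ ^ p.toReal := fun n v hv =>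
    csInf_le (hNb n) ⟨v, hv, rfl⟩
  have hIb : BddAbove (range I) := by
    refine ⟨B ^ p.toReal, ?_⟩
    rintro _ ⟨n, rfl⟩
    exact (hIle n _ (hCmem n)).trans
      (Real.rpow_le_rpow (norm_nonneg _) (hbdd n _ (hCmem n)) hq0.le)
  have hIlim := tendsto_atTop_ciSup hImono hIb
  set J := ⨆ n, I n
  have hex : ∀ n : ℕ, ∃ v ∈ C n, ‖slopeLp v.1‖ ^ p.toReal < I n + 1 / ((n : ℝ) + 1) := by
    intro n
    obtain ⟨_, ⟨v, hv, rfl⟩, h⟩ := exists_lt_of_csInf_lt (hNne n)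
      (show sInf (N n) < I n + 1 / ((n : ℝ) + 1) by
        have : (0 : ℝ) < 1 / ((n : ℝ) + 1) := by positivity
        linarith)
    exact ⟨v, hv, h⟩
  choose v hvC hvI using hex
  have hhalf : ∀ n k, n ≤ k →
      I n ≤ ‖(1 / 2 : ℝ) • (slopeLp (v n).1 + slopeLp (v k).1)‖ ^ p.toReal := by
    intro n k hnk
    have hmid : (1 / 2 : ℝ) • v n + (1 / 2 : ℝ) • v k ∈ C n :=
      hCconv n (hvC n) (hCmono hnk (hvC k)) (by norm_num) (by norm_num) (by norm_num)
    refine (hIle n _ hmid).trans (Real.rpow_le_rpow (norm_nonneg _) ?_ hq0.le)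
    have hle : slopeLp ((1 / 2 : ℝ) • v n + (1 / 2 : ℝ) • v k).1
        ≤ (1 / 2 : ℝ) • (slopeLp (v n).1 + slopeLp (v k).1) := by
      refine (slopeLp_add_le _ _).trans (le_of_eq ?_)
      rw [Prod.smul_fst, Prod.smul_fst, slopeLp_smul, slopeLp_smul,
        abs_of_nonneg (by norm_num : (0 : ℝ) ≤ 1 / 2), smul_add]
    refine norm_le_norm_of_abs_le_abs ?_
    have h0 := slopeLp_nonneg ((1 / 2 : ℝ) • v n + (1 / 2 : ℝ) • v k).1
    rwa [abs_of_nonneg h0, abs_of_nonneg (h0.trans hle)]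
  have hcau : CauchySeq fun n => slopeLp (v n).1 := by
    rw [Metric.cauchySeq_iff']
    intro ε hε
    have hεq := Real.rpow_pos_of_pos hε p.toReal
    set R := B ^ p.toReal
    have hR : ∀ n, ‖slopeLp (v n).1‖ ^ p.toReal ≤ R := fun n =>
      Real.rpow_le_rpow (norm_nonneg _) (hbdd n _ (hvC n)) hq0.le
    have hR0 : 0 ≤ R := le_trans (by positivity) (hR 0)
    obtain ⟨K, hK, hKuc⟩ := Lp_uc (m := m) (p := p)
      (ε := ε ^ p.toReal / (4 * (R + 1))) (by positivity)
    -- the defect tends to zero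
    have hdef : Tendsto (fun n : ℕ => K * (J - I n + 1 / ((n : ℝ) + 1))) atTop
        (𝓝 (K * (J - J + 0))) :=
      ((tendsto_const_nhds.sub hIlim).add tendsto_one_div_add_atTop_nhds_zero_nat).const_mul K
    rw [sub_self, add_zero, mul_zero] at hdef
    obtain ⟨n, hn⟩ := (hdef.eventually (gt_mem_nhds (half_pos hεq))).exists
    refine ⟨n, fun k hk => ?_⟩
    rw [dist_eq_norm, norm_sub_rev]
    refine (Real.rpow_lt_rpow_iff (norm_nonneg _) hε.le hq0).1 ?_
    have h1 := hKuc (slopeLp (v n).1) (slopeLp (v k).1) (slopeLp_nonneg _) (slopeLp_nonneg _)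
    have h2 : ε ^ p.toReal / (4 * (R + 1)) *
        (‖slopeLp (v n).1‖ ^ p.toReal + ‖slopeLp (v k).1‖ ^ p.toReal) ≤ ε ^ p.toReal / 2 := by
      calc _ ≤ ε ^ p.toReal / (4 * (R + 1)) * (2 * (R + 1)) := by
            gcongr
            linarith [hR n, hR k]
        _ = ε ^ p.toReal / 2 := by field_simp; norm_num
    have h3 : (‖slopeLp (v n).1‖ ^ p.toReal + ‖slopeLp (v k).1‖ ^ p.toReal) / 2
        - ‖(1 / 2 : ℝ) • (slopeLp (v n).1 + slopeLp (v k).1)‖ ^ p.toReal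
        ≤ J - I n + 1 / ((n : ℝ) + 1) := by
      have e1 := hhalf n k hk
      have e2 := hvI n
      have e3 := hvI k
      have e4 : I k ≤ J := le_ciSup hIb k
      have e5 : I n ≤ J := le_ciSup hIb n
      have e6 : 1 / ((k : ℝ) + 1) ≤ 1 / ((n : ℝ) + 1) := by gcongr
      linarith
    have h4 := mul_le_mul_of_nonneg_left h3 hK.le
    linarith
  obtain ⟨G, hG⟩ := cauchySeq_tendsto_of_complete hcau
  refine ⟨G, ⟨fun n => (v n).1, ?_, TendstoWeakly.of_tendsto hG⟩, fun H hH => ?_⟩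
  · refine TendstoL0.of_ae (fun n => lipDomain_aesm _) ?_
    filter_upwards [hu] with x hx
    rw [Metric.tendsto_atTop] at hx ⊢
    intro ε hε
    obtain ⟨n, hn⟩ := hx ε hε
    refine ⟨n, fun k hk => ?_⟩
    have hcv : Convex ℝ {v : lipDomain m p × Lp ℝ p m | (v.1 : M → ℝ) x ∈ Metric.ball (f x) ε} :=
      (convex_ball (f x) ε).linear_preimage ((LinearMap.proj x).comp
        ((lipDomain m p).subtype.comp (LinearMap.fst ℝ (lipDomain m p) (Lp ℝ p m))))
    exact hCsub hcv (fun j hj => hn j hj) (hCmono hk (hvC k))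
  · -- the second components converge weakly to `H`
    have hw : TendstoWeakly (fun n => (v n).2) H := by
      intro φ
      have hx := hH φ
      rw [Metric.tendsto_atTop] at hx ⊢
      intro ε hε
      obtain ⟨n, hn⟩ := hx ε hε
      refine ⟨n, fun k hk => ?_⟩
      have hcv : Convex ℝ {v : lipDomain m p × Lp ℝ p m | φ v.2 ∈ Metric.ball (φ H) ε} :=
        (convex_ball (φ H) ε).linear_preimage ((φ : Lp ℝ p m →ₗ[ℝ] ℝ).comp
          (LinearMap.snd ℝ (lipDomain m p) (Lp ℝ p m)))
      exact hCsub hcv (fun j hj => hn j hj) (hCmono hk (hvC k))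
    rw [← sub_nonneg]
    refine TendstoWeakly.nonneg (u := fun n => (v n).2 - slopeLp (v n).1) (fun φ => ?_)
      fun n => sub_nonneg.2 (hslope n _ (hvC n))
    simp only [map_sub]
    exact (hw φ).sub (TendstoWeakly.of_tendsto hG φ)

variable [SigmaFinite m]

theorem weakSlopeLimits_nonempty {f : M → ℝ} (hf : lscHull m p f < ⊤) :
    (weakSlopeLimits m p f).Nonempty := by
  obtain ⟨u, hu, B, hB⟩ := (lscHull_lt_top_iff f).1 hf
  obtain ⟨φ, hφ, hφ2⟩ := hu.exists_ae
  obtain ⟨G, hG, -⟩ := exists_weakSlopeLimit (fun n => u (φ n)) (fun n => slopeLp (u (φ n))) hφ2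
    (fun n => le_rfl) (fun n => hB (φ n))
  exact ⟨G, hG⟩

end Relaxation

/-! ### The relaxed slope -/

section RelaxedSlope

variable {M : Type*} [MetricSpace M] [MeasurableSpace M] [BorelSpace M]

variable {m : Measure M} {p : ℝ≥0∞} [h1 : Fact (1 < p)]

theorem norm_slopeLp_smul (c : ℝ) (u : lipDomain m p) :
    ‖slopeLp (c • u)‖ = |c| * ‖slopeLp u‖ := by
  rw [slopeLp_smul, norm_smul, Real.norm_eq_abs, abs_abs]

theorem norm_slopeLp_add_le (u v : lipDomain m p) :
    ‖slopeLp (u + v)‖ ≤ ‖slopeLp u‖ + ‖slopeLp v‖ := by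
  refine le_trans (norm_le_norm_of_abs_le_abs ?_) (norm_add_le _ _)
  have h := slopeLp_add_le u v
  have h0 := slopeLp_nonneg (u + v)
  rwa [abs_of_nonneg h0, abs_of_nonneg (h0.trans h)]

variable [h2 : Fact (p < ⊤)]

theorem lscHull_lt_top_of_ae {f : M → ℝ} (u : ℕ → lipDomain m p)
    (hu : ∀ᵐ x ∂m, Tendsto (fun n => (u n : M → ℝ) x) atTop (𝓝 (f x))) {B : ℝ}
    (hB : ∀ n, ‖slopeLp (u n)‖ ≤ B) : lscHull m p f < ⊤ :=
  (lscHull_lt_top_iff f).2 ⟨u, TendstoL0.of_ae (fun _ => lipDomain_aesm _) hu, B, hB⟩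

variable [SigmaFinite m]

theorem exists_ae_of_lscHull {f : M → ℝ} (hf : lscHull m p f < ⊤) :
    ∃ u : ℕ → lipDomain m p,
      (∀ᵐ x ∂m, Tendsto (fun n => (u n : M → ℝ) x) atTop (𝓝 (f x))) ∧
      ∃ B, ∀ n, ‖slopeLp (u n)‖ ≤ B := by
  obtain ⟨u, hu, B, hB⟩ := (lscHull_lt_top_iff f).1 hf
  obtain ⟨φ, -, hφ⟩ := hu.exists_ae
  exact ⟨fun n => u (φ n), hφ, B, fun n => hB _⟩

variable (m p) in
/-- The domain of the relaxed functional: the classes `f ∈ L⁰(m)` at which the lower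
semicontinuous hull of `f ↦ ∫ (lip f)^p dm` is finite. -/
def relaxedDomain : Submodule ℝ (M →ₘ[m] ℝ) where
  carrier := {f | lscHull m p f < ⊤}
  add_mem' := by
    intro f g hf hg
    obtain ⟨u, hu, B, hB⟩ := exists_ae_of_lscHull hf
    obtain ⟨v, hv, B', hB'⟩ := exists_ae_of_lscHull hg
    refine lscHull_lt_top_of_ae (fun n => u n + v n) ?_ (B := B + B')
      fun n => (norm_slopeLp_add_le _ _).trans (add_le_add (hB n) (hB' n))
    filter_upwards [hu, hv, AEEqFun.coeFn_add f g] with x h1 h2 h3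
    rw [h3]
    exact h1.add h2
  zero_mem' := by
    refine lscHull_lt_top_of_ae (fun _ => 0) ?_ (fun n => le_rfl)
    filter_upwards [AEEqFun.coeFn_zero (α := M) (μ := m) (β := ℝ)] with x hx
    rw [hx]
    exact tendsto_const_nhds
  smul_mem' := by
    intro c f hf
    obtain ⟨u, hu, B, hB⟩ := exists_ae_of_lscHull hf
    refine lscHull_lt_top_of_ae (fun n => c • u n) ?_ (B := |c| * B) fun n => ?_
    · filter_upwards [hu, AEEqFun.coeFn_smul c f] with x h1 h3
      rw [h3]
      exact h1.const_smul c
    · rw [norm_slopeLp_smul]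
      gcongr
      exact hB n

theorem exists_relaxedSlope (f : relaxedDomain m p) :
    ∃ G, IsGreatest (lowerBounds (weakSlopeLimits m p f)) G :=
  exists_greatest_lowerBounds (weakSlopeLimits_nonempty f.2) weakSlopeLimits_nonneg

/-- The relaxed slope `|Df|_{*,p}`: the greatest `G ∈ L^p(m)` such that `G ≤ G'` a.e. for every
weak `L^p`-limit `G'` of `lip fₙ` along a sequence `fₙ → f` in `L⁰(m)`. -/
def relaxedSlope (f : relaxedDomain m p) : Lp ℝ p m :=
  (exists_relaxedSlope f).choose

theorem isGreatest_relaxedSlope (f : relaxedDomain m p) :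
    IsGreatest (lowerBounds (weakSlopeLimits m p f)) (relaxedSlope f) :=
  (exists_relaxedSlope f).choose_spec

theorem relaxedSlope_nonneg (f : relaxedDomain m p) : 0 ≤ relaxedSlope f :=
  (isGreatest_relaxedSlope f).2 weakSlopeLimits_nonneg

theorem relaxedSlope_add_le (f g : relaxedDomain m p) :
    relaxedSlope (f + g) ≤ relaxedSlope f + relaxedSlope g := by
  have key : ∀ G ∈ weakSlopeLimits m p f, ∀ G' ∈ weakSlopeLimits m p g,
      relaxedSlope (f + g) ≤ G + G' := by
    rintro G ⟨u, hu, huG⟩ G' ⟨v, hv, hvG⟩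
    obtain ⟨φ, hφ, hφu⟩ := hu.exists_ae
    obtain ⟨ψ, hψ, hψv⟩ := (hv.comp hφ).exists_ae
    have hu' : TendstoWeakly (fun n => slopeLp (u (φ (ψ n)))) G :=
      fun χ => (huG χ).comp (hφ.comp hψ).tendsto_atTop
    have hv' : TendstoWeakly (fun n => slopeLp (v (φ (ψ n)))) G' :=
      fun χ => (hvG χ).comp (hφ.comp hψ).tendsto_atTop
    have hw : TendstoWeakly
        (fun n => slopeLp (u (φ (ψ n))) + slopeLp (v (φ (ψ n)))) (G + G') := by
      intro χ
      simp only [map_add]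
      exact (hu' χ).add (hv' χ)
    obtain ⟨B, hB⟩ := hw.bdd
    obtain ⟨H, hH, hH'⟩ := exists_weakSlopeLimit (f := ((f + g : relaxedDomain m p) : M →ₘ[m] ℝ))
      (fun n => u (φ (ψ n)) + v (φ (ψ n))) _ (by
        filter_upwards [hφu, hψv, AEEqFun.coeFn_add (f : M →ₘ[m] ℝ) (g : M →ₘ[m] ℝ)]
          with x h1 h2 h3
        rw [Submodule.coe_add, h3]
        exact (h1.comp hψ.tendsto_atTop).add h2) (fun n => slopeLp_add_le _ _) hB
    exact ((isGreatest_relaxedSlope (f + g)).1 hH).trans (hH' _ hw)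
  rw [← sub_le_iff_le_add]
  refine (isGreatest_relaxedSlope f).2 fun G hG => ?_
  rw [sub_le_iff_le_add, ← sub_le_iff_le_add']
  refine (isGreatest_relaxedSlope g).2 fun G' hG' => ?_
  rw [sub_le_iff_le_add']
  exact key G hG G' hG'

theorem relaxedSlope_smul_le (c : ℝ) (f : relaxedDomain m p) :
    relaxedSlope (c • f) ≤ |c| • relaxedSlope f := by
  have key : ∀ G ∈ weakSlopeLimits m p f, relaxedSlope (c • f) ≤ |c| • G := by
    rintro G ⟨u, hu, huG⟩
    obtain ⟨φ, hφ, hφu⟩ := hu.exists_ae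
    refine (isGreatest_relaxedSlope (c • f)).1 ⟨fun n => c • u (φ n),
      TendstoL0.of_ae (fun n => lipDomain_aesm _) ?_, fun χ => ?_⟩
    · filter_upwards [hφu, AEEqFun.coeFn_smul c (f : M →ₘ[m] ℝ)] with x h1 h3
      rw [Submodule.coe_smul, h3]
      exact h1.const_smul c
    · simp only [slopeLp_smul, map_smul]
      exact ((huG χ).comp hφ.tendsto_atTop).const_smul |c|
  rcases eq_or_ne c 0 with rfl | hc
  · obtain ⟨G, hG⟩ := weakSlopeLimits_nonempty f.2
    simpa using key G hG
  · have hc' : 0 < |c| := abs_pos.2 hc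
    have h : |c|⁻¹ • relaxedSlope (c • f) ≤ relaxedSlope f :=
      (isGreatest_relaxedSlope f).2 fun G hG => by
        have := Lp_smul_le (inv_nonneg.2 hc'.le) (key G hG)
        rwa [smul_smul, inv_mul_cancel₀ hc'.ne', one_smul] at this
    have := Lp_smul_le hc'.le h
    rwa [smul_smul, mul_inv_cancel₀ hc'.ne', one_smul] at this

theorem relaxedSlope_smul (c : ℝ) (f : relaxedDomain m p) :
    relaxedSlope (c • f) = |c| • relaxedSlope f := by
  refine le_antisymm (relaxedSlope_smul_le c f) ?_
  rcases eq_or_ne c 0 with rfl | hc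
  · simpa using relaxedSlope_nonneg ((0 : ℝ) • f)
  · have hc' : 0 < |c| := abs_pos.2 hc
    have h := Lp_smul_le hc'.le (relaxedSlope_smul_le c⁻¹ (c • f))
    rwa [smul_smul, smul_smul, inv_mul_cancel₀ hc, one_smul, abs_inv, mul_inv_cancel₀ hc'.ne',
      one_smul] at h

end RelaxedSlope

/-! ### The module generated by a sublinear `L^p`-valued functional -/

section Module

variable {M : Type*} [MeasurableSpace M]

/-- A subadditive and absolutely homogeneous functional `f ↦ g_f`, defined on a linear subspace
of `L⁰(m)` and with values in the non-negative elements of `L^p(m)`. -/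
structure SublinearFunctional (m : Measure M) (p : ℝ≥0∞) where
  /-- the domain of definition -/
  domain : Submodule ℝ (M →ₘ[m] ℝ)
  /-- the value `g_f` -/
  val : domain → Lp ℝ p m
  val_nonneg : ∀ f, 0 ≤ val f
  val_add_le : ∀ f h, val (f + h) ≤ val f + val h
  val_smul : ∀ (c : ℝ) (f), val (c • f) = |c| • val f

namespace SublinearFunctional

variable {m : Measure M} {p : ℝ≥0∞} (F : SublinearFunctional m p)

/-- The pointwise norm `x ↦ g_{s x} x` of a family `s` of elements of the domain; if `s = f i`
on `A i` for a partition `(A i)`, it equals `g_{f i}` on `A i`. -/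
def pointwiseNorm (s : M → F.domain) (x : M) : ℝ := F.val (s x) x

/-- A family with countably many values, all of whose level sets are measurable. It is the same
thing as a sequence `(f i, A i)` with `f i` in the domain and `(A i)` a countable measurable
partition, up to the labelling of the pieces. -/
def IsSimple (s : M → F.domain) : Prop :=
  (range s).Countable ∧ ∀ f, MeasurableSet (s ⁻¹' {f})

variable {F}

theorem IsSimple.measurable_comp {β : Type*} [MeasurableSpace β] {s : M → F.domain}
    (hs : F.IsSimple s) {φ : F.domain → M → β} (hφ : ∀ f, Measurable (φ f)) :
    Measurable fun x => φ (s x) x := by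
  intro B hB
  have : (fun x => φ (s x) x) ⁻¹' B = ⋃ f ∈ range s, s ⁻¹' {f} ∩ φ f ⁻¹' B := by
    ext x
    simp only [mem_preimage, mem_iUnion, mem_inter_iff, mem_singleton_iff, exists_prop]
    exact ⟨fun h => ⟨s x, ⟨x, rfl⟩, rfl, h⟩, by rintro ⟨f, -, rfl, h⟩; exact h⟩
  rw [this]
  exact MeasurableSet.biUnion hs.1 fun f _ => (hs.2 f).inter (hφ f hB)

theorem IsSimple.aesm {s : M → F.domain} (hs : F.IsSimple s) :
    AEStronglyMeasurable (F.pointwiseNorm s) m :=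
  (hs.measurable_comp (φ := fun f x => F.val f x)
    fun f => (Lp.stronglyMeasurable (F.val f)).measurable).aestronglyMeasurable

theorem IsSimple.add {s t : M → F.domain} (hs : F.IsSimple s) (ht : F.IsSimple t) :
    F.IsSimple (s + t) := by
  refine ⟨((hs.1.prod ht.1).image fun q => q.1 + q.2).mono ?_, fun f => ?_⟩
  · rintro _ ⟨x, rfl⟩
    exact ⟨(s x, t x), ⟨⟨x, rfl⟩, ⟨x, rfl⟩⟩, rfl⟩
  · have : (s + t) ⁻¹' {f} = ⋃ a ∈ range s, s ⁻¹' {a} ∩ t ⁻¹' {f - a} := by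
      ext x
      simp only [mem_preimage, mem_iUnion, mem_inter_iff, mem_singleton_iff, exists_prop,
        Pi.add_apply]
      constructor
      · rintro rfl
        exact ⟨s x, ⟨x, rfl⟩, rfl, by simp⟩
      · rintro ⟨a, -, rfl, h⟩
        simp [h]
    rw [this]
    exact MeasurableSet.biUnion hs.1 fun a _ => (hs.2 a).inter (ht.2 _)

theorem IsSimple.comp {s : M → F.domain} (hs : F.IsSimple s) (φ : F.domain → F.domain) :
    F.IsSimple (fun x => φ (s x)) := by
  refine ⟨(hs.1.image φ).mono ?_, fun f => ?_⟩
  · rintro _ ⟨x, rfl⟩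
    exact ⟨s x, ⟨x, rfl⟩, rfl⟩
  · have : (fun x => φ (s x)) ⁻¹' {f} = ⋃ a ∈ range s, s ⁻¹' {a} ∩ {_x | φ a = f} := by
      ext x
      simp only [mem_preimage, mem_iUnion, mem_inter_iff, mem_singleton_iff, exists_prop]
      exact ⟨fun h => ⟨s x, ⟨x, rfl⟩, rfl, h⟩, by rintro ⟨a, -, rfl, h⟩; exact h⟩
    rw [this]
    exact MeasurableSet.biUnion hs.1 fun a _ => (hs.2 a).inter (MeasurableSet.const _)

theorem IsSimple.ae {s : M → F.domain} (hs : F.IsSimple s) {P : F.domain → M → Prop}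
    (h : ∀ f, ∀ᵐ x ∂m, P f x) : ∀ᵐ x ∂m, P (s x) x := by
  have : ∀ᵐ x ∂m, ∀ f ∈ range s, P f x := (ae_ball_iff hs.1).2 fun f _ => h f
  exact this.mono fun x hx => hx _ ⟨x, rfl⟩

theorem pointwiseNorm_nonneg {s : M → F.domain} (hs : F.IsSimple s) :
    ∀ᵐ x ∂m, 0 ≤ F.pointwiseNorm s x :=
  hs.ae (P := fun f x => 0 ≤ F.val f x) fun f => (Lp.coeFn_nonneg _).2 (F.val_nonneg f)

theorem pointwiseNorm_smul {s : M → F.domain} (hs : F.IsSimple s) (c : ℝ) :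
    F.pointwiseNorm (c • s) =ᵐ[m] |c| • F.pointwiseNorm s := by
  refine hs.ae (P := fun f x => F.val (c • f) x = |c| • F.val f x) fun f => ?_
  rw [F.val_smul]
  exact Lp.coeFn_smul _ _

theorem pointwiseNorm_add_le {s t : M → F.domain} (hs : F.IsSimple s) (ht : F.IsSimple t) :
    ∀ᵐ x ∂m, F.pointwiseNorm (s + t) x ≤ F.pointwiseNorm s x + F.pointwiseNorm t x := by
  have : ∀ᵐ x ∂m, ∀ f ∈ range s, F.val (f + t x) x ≤ F.val f x + F.val (t x) x := by
    refine (ae_ball_iff hs.1).2 fun f _ => ht.ae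
      (P := fun h x => F.val (f + h) x ≤ F.val f x + F.val h x) fun h => ?_
    filter_upwards [(Lp.coeFn_le _ _).2 (F.val_add_le f h), Lp.coeFn_add (F.val f) (F.val h)]
      with x h1 h2
    rwa [h2] at h1
  exact this.mono fun x hx => hx _ ⟨x, rfl⟩

theorem norm_pointwiseNorm_add_le {s t : M → F.domain} (hs : F.IsSimple s) (ht : F.IsSimple t) :
    ∀ᵐ x ∂m, ‖F.pointwiseNorm (s + t) x‖ ≤ ‖(F.pointwiseNorm s + F.pointwiseNorm t) x‖ := by
  filter_upwards [pointwiseNorm_add_le hs ht, pointwiseNorm_nonneg (hs.add ht)] with x h1 h2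
  rw [Pi.add_apply, Real.norm_of_nonneg h2, Real.norm_of_nonneg (h2.trans h1)]
  exact h1

variable (F)

/-- The pre-module: simple families whose pointwise norm is in `L^p(m)`. -/
def Pfm : Submodule ℝ (M → F.domain) where
  carrier := {s | F.IsSimple s ∧ MemLp (F.pointwiseNorm s) p m}
  add_mem' := by
    rintro s t ⟨hs, hs'⟩ ⟨ht, ht'⟩
    exact ⟨hs.add ht, (hs'.add ht').mono (hs.add ht).aesm (norm_pointwiseNorm_add_le hs ht)⟩
  zero_mem' := by
    have h0 : F.IsSimple 0 := ⟨(countable_singleton 0).mono (by rintro _ ⟨x, rfl⟩; rfl),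
      fun f => MeasurableSet.const ((0 : F.domain) = f)⟩
    have := pointwiseNorm_smul h0 0
    rw [zero_smul, abs_zero, zero_smul] at this
    exact ⟨h0, (memLp_congr_ae this).2 MemLp.zero⟩
  smul_mem' := by
    rintro c s ⟨hs, hs'⟩
    exact ⟨hs.comp (c • ·), (memLp_congr_ae (pointwiseNorm_smul hs c)).2 (hs'.const_smul _)⟩

variable [hp : Fact (1 ≤ p)]

/-- The seminorm `‖s‖ = ‖ |s| ‖_{L^p(m)}` on the pre-module. -/
def pfmSeminorm : Seminorm ℝ F.Pfm :=
  Seminorm.of (fun s => (eLpNorm (F.pointwiseNorm s.1) p m).toReal)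
    (fun s t => by
      rw [← ENNReal.toReal_add s.2.2.2.ne t.2.2.2.ne]
      refine ENNReal.toReal_mono (ENNReal.add_ne_top.2 ⟨s.2.2.2.ne, t.2.2.2.ne⟩) ?_
      exact (eLpNorm_mono_ae (norm_pointwiseNorm_add_le s.2.1 t.2.1)).trans
        (eLpNorm_add_le s.2.1.aesm t.2.1.aesm hp.out))
    (fun c s => by
      have := eLpNorm_congr_ae (p := p) (pointwiseNorm_smul s.2.1 c)
      simp only [Submodule.coe_smul]
      rw [this, eLpNorm_const_smul, ENNReal.toReal_mul]
      simp)

instance : SeminormedAddCommGroup F.Pfm :=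
  F.pfmSeminorm.toAddGroupSeminorm.toSeminormedAddCommGroup

instance : NormedSpace ℝ F.Pfm where
  norm_smul_le c s := (map_smul_eq_mul F.pfmSeminorm c s).le

/-- The module generated by the functional: the completion of the pre-module modulo the families
of norm zero. -/
abbrev GeneratedModule : Type _ := UniformSpace.Completion F.Pfm

end SublinearFunctional

end Module

/-! ### The cotangent module, the Cheeger energy and the main notions -/

section Main

variable {M : Type*} [MetricSpace M] [MeasurableSpace M] [BorelSpace M]

/-- The functional `f ↦ |Df|_{*,p}`. -/
def relaxedFunctional (m : Measure M) [SigmaFinite m] (p : ℝ≥0∞) [Fact (1 < p)]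
    [Fact (p < ⊤)] : SublinearFunctional m p where
  domain := relaxedDomain m p
  val := relaxedSlope
  val_nonneg := relaxedSlope_nonneg
  val_add_le := relaxedSlope_add_le
  val_smul := relaxedSlope_smul

/-- The `L^p`-cotangent module `L^p(T^*M)`, as a Banach space. -/
abbrev CotangentModule (m : Measure M) [SigmaFinite m] (p : ℝ≥0∞) [Fact (1 < p)]
    [Fact (p < ⊤)] : Type _ :=
  (relaxedFunctional m p).GeneratedModule

open scoped Classical in
/-- The Cheeger energy on `L⁰(m)`: `∫ |Df|_{*,2}² dm` on the domain of the relaxed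
functional with `p = 2`, and `∞` elsewhere. -/
def cheegerEnergy (m : Measure M) [SigmaFinite m] (f : M →ₘ[m] ℝ) : ℝ≥0∞ :=
  if hf : f ∈ relaxedDomain m 2 then
    ∫⁻ x, ENNReal.ofReal (relaxedSlope (⟨f, hf⟩ : relaxedDomain m 2) x) ^ 2 ∂m
  else ⊤

/-- An extended-real-valued functional on a real vector space is a quadratic form. -/
def IsQuadraticForm {V : Type*} [AddCommGroup V] [Module ℝ V] (E : V → ℝ≥0∞) : Prop :=
  (∀ f g, E (f + g) + E (f - g) = 2 * E f + 2 * E g) ∧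
    ∀ (c : ℝ) (f), E (c • f) = ENNReal.ofReal (c ^ 2) * E f

/-- `(M, d, m)` is infinitesimally Riemannian: `f ↦ (lip f)²` is quadratic a.e. on Lipschitz
functions. -/
def InfinitesimallyRiemannian (m : Measure M) : Prop :=
  ∀ f g : M → ℝ, IsLip f → IsLip g →
    ∀ᵐ x ∂m, lip (f + g) x ^ 2 + lip (f - g) x ^ 2 = 2 * lip f x ^ 2 + 2 * lip g x ^ 2

/-- `(M, d, m)` is infinitesimally Hilbertian: the Cheeger energy is a quadratic form. -/
def InfinitesimallyHilbertian (m : Measure M) [SigmaFinite m] : Prop :=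
  IsQuadraticForm (cheegerEnergy m)

/-- A measure that is finite on bounded sets. -/
class FiniteOnBounded (m : Measure M) : Prop where
  lt_top : ∀ s : Set M, Bornology.IsBounded s → m s < ⊤

instance (m : Measure M) [h : FiniteOnBounded m] : SigmaFinite m := by
  rcases isEmpty_or_nonempty M with hM | ⟨⟨x₀⟩⟩
  · rw [Measure.eq_zero_of_isEmpty m]
    infer_instance
  · exact ⟨⟨{ set := fun n => Metric.ball x₀ n
              set_mem := fun _ => trivial
              finite := fun n => h.lt_top _ Metric.isBounded_ball
              spanning := Metric.iUnion_ball_nat x₀ }⟩⟩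

/-- Reflexivity of a normed space: the canonical map to the bidual is onto. -/
def IsReflexiveSpace (X : Type*) [NormedAddCommGroup X] [NormedSpace ℝ X] : Prop :=
  Function.Surjective (NormedSpace.inclusionInDoubleDual ℝ X)

end Main

end MetricSobolev

end

/-!
The parallelogram identity for `lip` is a pointwise quadratic relation, while the relaxed slope is
defined through weak limits, along which such relations are lost. Mazur's lemma repairs this:
suitable convex combinations of the tails of an approximating sequence have slopes dominated by a
strongly convergent sequence. If the slopes of `u n → f` and `v n → g` are controlled in this way,
then the slopes of `u n + v n` and `u n - v n` are bounded in the reflexive space `L^p × L^p`, and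
after passing simultaneously to convex combinations of both the identity becomes
`|D(f+g)|² + |D(f-g)|² ≤ 2 |Df|² + 2 |Dg|²` almost everywhere. For `p = 2` we integrate, and apply
the resulting inequality also to `f + g` and `f - g`, which yields its converse.

For reflexivity, a compactness argument turns the pointwise inequality together with the triangle
inequality into a uniform convexity estimate that is homogeneous of degree `p`. It can therefore
be integrated, is inherited by the completion, and the Milman–Pettis theorem applies.
-/

namespace MetricSobolev

/-! ### Reflexive spaces -/

section Reflexive

theorem exists_forall_apply_lt_of_notMem_closure {E : Type*} [NormedAddCommGroup E]
    [NormedSpace ℝ E] {S : Set (WeakDual ℝ E)} (hS : Convex ℝ S) {ξ : WeakDual ℝ E}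
    (hξ : ξ ∉ closure S) : ∃ (x : E) (s : ℝ), (∀ η ∈ S, η x < s) ∧ s < ξ x := by
  have : LocallyConvexSpace ℝ (WeakDual ℝ E) :=
    inferInstanceAs (LocallyConvexSpace ℝ (WeakBilin (topDualPairing ℝ E)))
  obtain ⟨f, s, hSs, hsξ⟩ := geometric_hahn_banach_closed_point hS.closure isClosed_closure hξ
  obtain ⟨x, rfl⟩ := LinearMap.dualEmbedding_surjective (topDualPairing ℝ E) f
  exact ⟨x, s, fun η hη => hSs η (subset_closure hη), hsξ⟩

variable {X : Type*} [NormedAddCommGroup X] [NormedSpace ℝ X]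

theorem exists_norm_le_one_lt_apply (f : StrongDual ℝ X) {r : ℝ} (hr : r < ‖f‖) :
    ∃ x, ‖x‖ ≤ 1 ∧ r < f x := by
  obtain ⟨x, hx, hrx⟩ := f.exists_lt_apply_of_lt_opNorm hr
  rcases lt_abs.1 (Real.norm_eq_abs (f x) ▸ hrx) with hpos | hneg
  · exact ⟨x, hx.le, hpos⟩
  · exact ⟨-x, by simpa only [norm_neg] using hx.le, by rwa [map_neg]⟩

theorem norm_mul_le_of_forall_closedBall {f : StrongDual ℝ X} {r s : ℝ} (hr : 0 ≤ r)
    (hf : ∀ x ∈ Metric.closedBall 0 r, f x ≤ s) : ‖f‖ * r ≤ s := by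
  have hs : 0 ≤ s := by simpa using hf 0 (Metric.mem_closedBall_self hr)
  rcases hr.eq_or_lt with rfl | hr
  · simpa using hs
  by_contra! hlt
  obtain ⟨x, hx, hfx⟩ := exists_norm_le_one_lt_apply f ((div_lt_iff₀ hr).2 hlt)
  have hrx : r • x ∈ Metric.closedBall 0 r := by
    rw [mem_closedBall_zero_iff, norm_smul, Real.norm_of_nonneg hr.le]
    exact mul_le_of_le_one_right hr.le hx
  have hle := hf _ hrx
  rw [map_smul, smul_eq_mul, mul_comm] at hle
  exact hle.not_gt ((div_lt_iff₀ hr).1 hfx)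

theorem exists_ultrafilter_tendsto_dual (ξ : StrongDual ℝ (StrongDual ℝ X)) :
    ∃ U : Ultrafilter X, Metric.closedBall 0 ‖ξ‖ ∈ U ∧
      ∀ φ : StrongDual ℝ X, Tendsto φ U (𝓝 (ξ φ)) := by
  let J : X →ₗ[ℝ] WeakDual ℝ (StrongDual ℝ X) :=
    StrongDual.toWeakDual.toLinearMap ∘ₗ (NormedSpace.inclusionInDoubleDual ℝ X).toLinearMap
  have hclosure : StrongDual.toWeakDual ξ ∈ closure (J '' Metric.closedBall 0 ‖ξ‖) := by
    by_contra hξ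
    obtain ⟨φ, s, hball, hs⟩ := exists_forall_apply_lt_of_notMem_closure
      ((convex_closedBall 0 ‖ξ‖).linear_image J) hξ
    have hφ : ‖φ‖ * ‖ξ‖ ≤ s := norm_mul_le_of_forall_closedBall (norm_nonneg ξ)
      fun x hx => (hball (J x) (mem_image_of_mem J hx)).le
    exact hs.not_ge ((Real.le_norm_self _).trans ((ξ.le_opNorm φ).trans (mul_comm ‖φ‖ ‖ξ‖ ▸ hφ)))
  rw [mem_closure_iff_clusterPt, ← map_principal] at hclosure
  obtain ⟨U, hU, hUξ⟩ := mapClusterPt_iff_ultrafilter.1 hclosure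
  exact ⟨U, le_principal_iff.1 hU, fun φ => ((WeakDual.eval_continuous φ).tendsto _).comp hUξ⟩

theorem cauchy_of_tendsto_dual [UniformConvexSpace X] {l : Filter X} [l.NeBot]
    {ξ : StrongDual ℝ (StrongDual ℝ X)} (hball : Metric.closedBall 0 ‖ξ‖ ∈ l)
    (hl : ∀ φ : StrongDual ℝ X, Tendsto φ l (𝓝 (ξ φ))) : Cauchy l := by
  refine Metric.cauchy_iff.2 ⟨inferInstance, fun ε hε => ?_⟩
  obtain ⟨δ, hδ, hconvex⟩ := exists_forall_closed_ball_dist_add_le_two_mul_sub X hε ‖ξ‖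
  obtain ⟨φ, hφ, hφξ⟩ := exists_norm_le_one_lt_apply ξ (sub_lt_self ‖ξ‖ (half_pos hδ))
  refine ⟨_, inter_mem hball ((hl φ).eventually (lt_mem_nhds hφξ)), ?_⟩
  rintro x ⟨hx, hφx⟩ y ⟨hy, hφy⟩
  rw [mem_closedBall_zero_iff] at hx hy
  rw [mem_ofPred_eq] at hφx hφy
  rw [dist_eq_norm]
  by_contra! hxy
  have hsum : φ (x + y) ≤ ‖x + y‖ := (Real.le_norm_self _).trans
    ((φ.le_opNorm _).trans (mul_le_of_le_one_left (norm_nonneg _) hφ))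
  rw [map_add] at hsum
  linarith [hconvex hx hy hxy]

theorem isReflexiveSpace_of_uniformConvexSpace [CompleteSpace X] [UniformConvexSpace X] :
    IsReflexiveSpace X := fun ξ => by
  obtain ⟨U, hball, hU⟩ := exists_ultrafilter_tendsto_dual ξ
  obtain ⟨x, hx⟩ := CompleteSpace.complete (cauchy_of_tendsto_dual hball hU)
  exact ⟨x, ContinuousLinearMap.ext fun φ =>
    tendsto_nhds_unique ((φ.continuous.tendsto x).mono_left hx) (hU φ)⟩

theorem IsReflexiveSpace.exists_tendsto_dual (hX : IsReflexiveSpace X) {ι : Type*}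
    (U : Ultrafilter ι) {z : ι → X} {B : ℝ} (hz : ∀ i, ‖z i‖ ≤ B) :
    ∃ x, ∀ φ : StrongDual ℝ X, Tendsto (fun i => φ (z i)) U (𝓝 (φ x)) := by
  let J := NormedSpace.inclusionInDoubleDual ℝ X
  obtain ⟨ξ, -, hξ⟩ := (WeakDual.isCompact_closedBall (0 : StrongDual ℝ (StrongDual ℝ X))
    B).ultrafilter_le_nhds (U.map fun i => StrongDual.toWeakDual (J (z i)))
    (le_principal_iff.2 (Ultrafilter.mem_map.2 (univ_mem' fun i =>
      mem_closedBall_zero_iff.2 ((NormedSpace.double_dual_bound ℝ X (z i)).trans (hz i)))))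
  obtain ⟨x, hx⟩ := hX (WeakDual.toStrongDual ξ)
  refine ⟨x, fun φ => ?_⟩
  have hφ : φ x = ξ φ := congrArg (fun η : StrongDual ℝ (StrongDual ℝ X) => η φ) hx
  rw [hφ]
  exact ((WeakDual.eval_continuous φ).tendsto ξ).comp hξ

theorem IsReflexiveSpace.prod {Y : Type*} [NormedAddCommGroup Y] [NormedSpace ℝ Y]
    (hX : IsReflexiveSpace X) (hY : IsReflexiveSpace Y) : IsReflexiveSpace (X × Y) := fun ξ => by
  obtain ⟨x, hx⟩ := hX (ξ ∘L (ContinuousLinearMap.compL ℝ (X × Y) X ℝ).flip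
    (ContinuousLinearMap.fst ℝ X Y))
  obtain ⟨y, hy⟩ := hY (ξ ∘L (ContinuousLinearMap.compL ℝ (X × Y) Y ℝ).flip
    (ContinuousLinearMap.snd ℝ X Y))
  refine ⟨(x, y), ContinuousLinearMap.ext fun φ => ?_⟩
  have hφx := DFunLike.congr_fun hx (φ ∘L ContinuousLinearMap.inl ℝ X Y)
  have hφy := DFunLike.congr_fun hy (φ ∘L ContinuousLinearMap.inr ℝ X Y)
  calc φ (x, y) = φ (x, 0) + φ (0, y) := by rw [← map_add, Prod.mk_add_mk, add_zero, zero_add]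
    _ = ξ (φ ∘L ContinuousLinearMap.inl ℝ X Y ∘L ContinuousLinearMap.fst ℝ X Y)
        + ξ (φ ∘L ContinuousLinearMap.inr ℝ X Y ∘L ContinuousLinearMap.snd ℝ X Y) :=
      congrArg₂ (· + ·) hφx hφy
    _ = ξ φ := by
      rw [← map_add]
      congr 1
      ext z <;> simp [Prod.mk_zero_zero]

end Reflexive

/-! ### Convex combinations of tails -/

section TailConvexCombination

/-- The sequence `y` is obtained from `z` by replacing each term by a convex combination of the
terms with at least the same index. Passing from `z` to such a `y` preserves limits and convex
constraints, and turns weak convergence into strong convergence. -/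
def IsTailConvexCombination {V : Type*} [AddCommGroup V] [Module ℝ V] (z y : ℕ → V) : Prop :=
  ∀ n, y n ∈ convexHull ℝ (z '' Ici n)

namespace IsTailConvexCombination

variable {V W : Type*} [AddCommGroup V] [Module ℝ V] [AddCommGroup W] [Module ℝ W] {z y : ℕ → V}

theorem mem_of_convex (h : IsTailConvexCombination z y) {S : Set V} (hS : Convex ℝ S) {n : ℕ}
    (hz : ∀ k, n ≤ k → z k ∈ S) : y n ∈ S :=
  convexHull_min (image_subset_iff.2 hz) hS (h n)

theorem map (h : IsTailConvexCombination z y) (T : V →ₗ[ℝ] W) :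
    IsTailConvexCombination (fun n => T (z n)) (fun n => T (y n)) := fun _ =>
  h.mem_of_convex ((convex_convexHull ℝ _).linear_preimage T) fun k hk =>
    subset_convexHull ℝ _ ⟨k, hk, rfl⟩

theorem comp (h : IsTailConvexCombination z y) {φ : ℕ → ℕ} (hφ : StrictMono φ) :
    IsTailConvexCombination z (y ∘ φ) := fun n =>
  convexHull_mono (image_mono (Ici_subset_Ici.2 (hφ.le_apply (x := n)))) (h (φ n))

variable {X : Type*} [NormedAddCommGroup X] [NormedSpace ℝ X]

theorem tendsto {z y : ℕ → X} (h : IsTailConvexCombination z y) {x : X}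
    (hz : Tendsto z atTop (𝓝 x)) : Tendsto y atTop (𝓝 x) := by
  rw [Metric.tendsto_atTop] at hz ⊢
  intro ε hε
  obtain ⟨N, hN⟩ := hz ε hε
  exact ⟨N, fun n hn => h.mem_of_convex (convex_ball x ε) fun k hk => hN k (hn.trans hk)⟩

theorem le_of_convexOn {z y : ℕ → X} (h : IsTailConvexCombination z y) {Q : X → ℝ}
    (hQ : ConvexOn ℝ univ Q) (hQc : Continuous Q) {b : ℕ → ℝ} {B : ℝ} (hzb : ∀ n, Q (z n) ≤ b n)
    (hb : Tendsto b atTop (𝓝 B)) {x : X} (hy : Tendsto y atTop (𝓝 x)) : Q x ≤ B := by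
  refine le_of_forall_gt_imp_ge_of_dense fun r hr => ?_
  obtain ⟨N, hN⟩ := eventually_atTop.1 (hb.eventually_le_const hr)
  refine le_of_tendsto ((hQc.tendsto x).comp hy) (eventually_atTop.2 ⟨N, fun n hn => ?_⟩)
  exact (h.mem_of_convex (hQ.convex_le r) fun k hk =>
    ⟨mem_univ _, (hzb k).trans (hN k (hn.trans hk))⟩).2

theorem ae_coe {M : Type*} [MeasurableSpace M] {m : Measure M} {p : ℝ≥0∞}
    {z y : ℕ → Lp ℝ p m × Lp ℝ p m} (h : IsTailConvexCombination z y) :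
    ∀ᵐ x ∂m, IsTailConvexCombination (fun n => ((z n).1 x, (z n).2 x))
      (fun n => ((y n).1 x, (y n).2 x)) := by
  refine ae_all_iff.2 fun n => ?_
  let K : M → Set (ℝ × ℝ) := fun x => convexHull ℝ ((fun k => ((z k).1 x, (z k).2 x)) '' Ici n)
  have hconvex : Convex ℝ {v : Lp ℝ p m × Lp ℝ p m | ∀ᵐ x ∂m, (v.1 x, v.2 x) ∈ K x} := by
    intro v hv w hw s t hs ht hst
    filter_upwards [hv, hw, Lp.coeFn_add (s • v.1) (t • w.1), Lp.coeFn_add (s • v.2) (t • w.2),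
      Lp.coeFn_smul s v.1, Lp.coeFn_smul t w.1, Lp.coeFn_smul s v.2, Lp.coeFn_smul t w.2]
      with x hvx hwx hadd₁ hadd₂ hsv₁ htw₁ hsv₂ htw₂
    have hmem := convex_convexHull ℝ _ hvx hwx hs ht hst
    simp only [Prod.fst_add, Prod.snd_add, Prod.smul_fst, Prod.smul_snd, hadd₁, hadd₂,
      Pi.add_apply, hsv₁, htw₁, hsv₂, htw₂]
    exact hmem
  have hz : ∀ k, n ≤ k → ∀ᵐ x ∂m, ((z k).1 x, (z k).2 x) ∈ K x := fun k hk =>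
    Eventually.of_forall fun _ => subset_convexHull ℝ _ ⟨k, hk, rfl⟩
  exact h.mem_of_convex hconvex hz

end IsTailConvexCombination

variable {V X : Type*} [AddCommGroup V] [Module ℝ V] [NormedAddCommGroup X] [NormedSpace ℝ X]

theorem mem_closure_of_tendsto_dual {S : Set X} (hS : Convex ℝ S) {ι : Type*} {l : Filter ι}
    [l.NeBot] {z : ι → X} {x : X} (hzS : ∀ᶠ i in l, z i ∈ S)
    (hz : ∀ φ : StrongDual ℝ X, Tendsto (fun i => φ (z i)) l (𝓝 (φ x))) : x ∈ closure S := by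
  by_contra hx
  obtain ⟨φ, s, hφx, hφS⟩ := geometric_hahn_banach_point_closed hS.closure isClosed_closure hx
  exact hφx.not_ge (ge_of_tendsto (hz φ) (hzS.mono fun i hi => (hφS _ (subset_closure hi)).le))

theorem exists_isTailConvexCombination_tendsto_of_tendsto_dual (T : V →ₗ[ℝ] X)
    (z : ℕ → V) {l : Filter ℕ} [l.NeBot] (hl : l ≤ atTop) {x : X}
    (hz : ∀ φ : StrongDual ℝ X, Tendsto (fun n => φ (T (z n))) l (𝓝 (φ x))) :
    ∃ y, IsTailConvexCombination z y ∧ Tendsto (fun n => T (y n)) atTop (𝓝 x) := by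
  have hclosure : ∀ n, x ∈ closure (T '' convexHull ℝ (z '' Ici n)) := fun n =>
    mem_closure_of_tendsto_dual ((convex_convexHull ℝ _).linear_image T)
      (((eventually_ge_atTop n).filter_mono hl).mono fun k hk =>
        mem_image_of_mem T (subset_convexHull ℝ _ (mem_image_of_mem z hk))) hz
  have hex : ∀ n : ℕ, ∃ v ∈ convexHull ℝ (z '' Ici n), dist (T v) x < 1 / ((n : ℝ) + 1) := by
    intro n
    obtain ⟨_, ⟨v, hv, rfl⟩, hdist⟩ := Metric.mem_closure_iff.1 (hclosure n) (1 / ((n : ℝ) + 1))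
      Nat.one_div_pos_of_nat
    exact ⟨v, hv, dist_comm x (T v) ▸ hdist⟩
  choose y hy hdist using hex
  exact ⟨y, hy, tendsto_iff_dist_tendsto_zero.2 (squeeze_zero (fun _ => dist_nonneg)
    (fun n => (hdist n).le) tendsto_one_div_add_atTop_nhds_zero_nat)⟩

theorem IsReflexiveSpace.exists_isTailConvexCombination_tendsto (hX : IsReflexiveSpace X)
    (T : V →ₗ[ℝ] X) {z : ℕ → V} {B : ℝ} (hz : ∀ n, ‖T (z n)‖ ≤ B) :
    ∃ y x, IsTailConvexCombination z y ∧ Tendsto (fun n => T (y n)) atTop (𝓝 x) := by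
  obtain ⟨x, hx⟩ := hX.exists_tendsto_dual (Filter.hyperfilter ℕ) hz
  obtain ⟨y, hzy, hyx⟩ :=
    exists_isTailConvexCombination_tendsto_of_tendsto_dual T z Nat.hyperfilter_le_atTop hx
  exact ⟨y, x, hzy, hyx⟩

end TailConvexCombination

/-! ### Uniform convexity from a parallelogram inequality -/

section PowerUniformlyConvex

/-- A quantitative form of uniform convexity, with the `q`-th power of the norm. In contrast to
the usual formulation it is homogeneous, so that it can be integrated and passes to completions. -/
def PowerUniformlyConvex (X : Type*) [SeminormedAddCommGroup X] (q : ℝ) : Prop :=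
  ∀ ε > 0, ∃ C > 0, ∀ x y : X, ‖x - y‖ ^ q ≤ ε * (‖x‖ ^ q + ‖y‖ ^ q)
    + C * ((‖x‖ ^ q + ‖y‖ ^ q) / 2 - (‖x + y‖ / 2) ^ q)

variable {X : Type*} [SeminormedAddCommGroup X] {q : ℝ}

theorem PowerUniformlyConvex.completion (hX : PowerUniformlyConvex X q) (hq : 0 ≤ q) :
    PowerUniformlyConvex (UniformSpace.Completion X) q := by
  intro ε hε
  obtain ⟨C, hC, hX⟩ := hX ε hε
  refine ⟨C, hC, fun x y => UniformSpace.Completion.induction_on₂ x y ?_ fun a b => ?_⟩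
  · exact isClosed_le (by fun_prop) (by fun_prop)
  · simpa only [← UniformSpace.Completion.coe_add, ← UniformSpace.Completion.coe_sub,
      UniformSpace.Completion.norm_coe] using hX a b

theorem PowerUniformlyConvex.uniformConvexSpace (hX : PowerUniformlyConvex X q) (hq : 1 ≤ q) :
    UniformConvexSpace X where
  uniform_convex ε hε := by
    obtain ⟨C, hC, hX⟩ := hX (ε ^ q / 4) (by positivity)
    refine ⟨ε ^ q / (C * q), by positivity, fun x hx y hy hxy => ?_⟩
    have hdist : ε ^ q ≤ ‖x - y‖ ^ q := by gcongr
    have hconvex : ε ^ q ≤ ε ^ q / 4 * 2 + C * (1 - (‖x + y‖ / 2) ^ q) := by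
      have hsplit := hdist.trans (hX x y)
      rw [hx, hy, Real.one_rpow] at hsplit
      linarith
    have hbernoulli : 1 + q * (‖x + y‖ / 2 - 1) ≤ (‖x + y‖ / 2) ^ q := by
      simpa only [add_sub_cancel] using one_add_mul_self_le_rpow_one_add
        (s := ‖x + y‖ / 2 - 1) (by linarith [norm_nonneg (x + y)]) hq
    have hlinear : ε ^ q ≤ C * q * (2 - ‖x + y‖) := by
      nlinarith
    rw [le_sub_comm, div_le_iff₀' (by positivity)]
    exact hlinear

end PowerUniformlyConvex

section SubParallelogram

/-- The relations between the norms `a, b, c, d` of `x, y, x + y, x - y` in a Euclidean space, with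
an inequality in place of the parallelogram identity. -/
structure SubParallelogram (a b c d : ℝ) : Prop where
  nonneg_left : 0 ≤ a
  nonneg_right : 0 ≤ b
  nonneg_add : 0 ≤ c
  nonneg_sub : 0 ≤ d
  add_le : c ≤ a + b
  sq_add_sq_le : c ^ 2 + d ^ 2 ≤ 2 * a ^ 2 + 2 * b ^ 2

theorem subParallelogram_norm {E : Type*} [SeminormedAddCommGroup E] [InnerProductSpace ℝ E]
    (x y : E) : SubParallelogram ‖x‖ ‖y‖ ‖x + y‖ ‖x - y‖ where
  nonneg_left := norm_nonneg x
  nonneg_right := norm_nonneg y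
  nonneg_add := norm_nonneg (x + y)
  nonneg_sub := norm_nonneg (x - y)
  add_le := norm_add_le x y
  sq_add_sq_le := by linarith [parallelogram_law_with_norm ℝ x y]

namespace SubParallelogram

variable {a b c d q : ℝ}

theorem div (h : SubParallelogram a b c d) {s : ℝ} (hs : 0 < s) :
    SubParallelogram (a / s) (b / s) (c / s) (d / s) where
  nonneg_left := div_nonneg h.nonneg_left hs.le
  nonneg_right := div_nonneg h.nonneg_right hs.le
  nonneg_add := div_nonneg h.nonneg_add hs.le
  nonneg_sub := div_nonneg h.nonneg_sub hs.le
  add_le := by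
    rw [← add_div]
    exact div_le_div_of_nonneg_right h.add_le hs.le
  sq_add_sq_le := by
    simp only [div_pow, mul_div_assoc', ← add_div]
    exact div_le_div_of_nonneg_right h.sq_add_sq_le (sq_nonneg s)

theorem half_rpow_le (h : SubParallelogram a b c d) (hq : 1 ≤ q) :
    (c / 2) ^ q ≤ (a ^ q + b ^ q) / 2 := by
  have hmean := (convexOn_rpow hq).2 h.nonneg_left h.nonneg_right (one_half_pos (α := ℝ)).le
    (one_half_pos (α := ℝ)).le (add_halves 1)
  simp only [smul_eq_mul] at hmean
  calc (c / 2) ^ q ≤ (1 / 2 * a + 1 / 2 * b) ^ q :=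
        Real.rpow_le_rpow (by linarith [h.nonneg_add]) (by linarith [h.add_le]) (by linarith)
    _ ≤ (a ^ q + b ^ q) / 2 := by linarith

theorem eq_zero_of_le_half_rpow (h : SubParallelogram a b c d) (hq : 1 < q)
    (hle : (a ^ q + b ^ q) / 2 ≤ (c / 2) ^ q) : d = 0 := by
  have hhalf : (c / 2) ^ q ≤ (1 / 2 * a + 1 / 2 * b) ^ q :=
    Real.rpow_le_rpow (by linarith [h.nonneg_add]) (by linarith [h.add_le]) (by linarith)
  have hab : a = b := by
    by_contra hne
    have hmean := (strictConvexOn_rpow hq).2 h.nonneg_left h.nonneg_right hne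
      (one_half_pos (α := ℝ)) one_half_pos (add_halves 1)
    simp only [smul_eq_mul] at hmean
    linarith
  subst hab
  have hca : 2 * a ≤ c := by
    have hac : a ^ q ≤ (c / 2) ^ q := by linarith
    linarith [(Real.rpow_le_rpow_iff h.nonneg_left (by linarith [h.nonneg_add])
      (by linarith)).1 hac]
  have hd : d ^ 2 ≤ 0 := by nlinarith [h.sq_add_sq_le, h.nonneg_left]
  exact pow_eq_zero_iff two_ne_zero |>.1 (hd.antisymm (sq_nonneg d))

end SubParallelogram

theorem exists_forall_le_add_mul_of_isCompact {Z : Type*} [TopologicalSpace Z] {K : Set Z}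
    (hK : IsCompact K) {f g : Z → ℝ} (hf : Continuous f) (hg : Continuous g)
    (hg_nonneg : ∀ z ∈ K, 0 ≤ g z) (hfg : ∀ z ∈ K, g z = 0 → f z ≤ 0) {ε : ℝ} (hε : 0 < ε) :
    ∃ C > 0, ∀ z ∈ K, f z ≤ ε + C * g z := by
  have hpos : ∀ z ∈ K ∩ {z | ε ≤ f z}, 0 < g z := fun z hz =>
    (hg_nonneg z hz.1).lt_of_ne fun h0 => (hε.trans_le hz.2).not_ge (hfg z hz.1 h0.symm)
  obtain ⟨C, hC⟩ := (hK.inter_right (isClosed_le continuous_const hf)).bddAbove_image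
    (hf.continuousOn.div hg.continuousOn fun z hz => (hpos z hz).ne')
  refine ⟨max C 1, by positivity, fun z hz => ?_⟩
  have hCg : 0 ≤ max C 1 * g z := mul_nonneg (by positivity) (hg_nonneg z hz)
  rcases le_total (f z) ε with hle | hle
  · linarith
  · have hquot : f z / g z ≤ max C 1 := (hC (mem_image_of_mem _ ⟨hz, hle⟩)).trans (le_max_left C 1)
    linarith [(div_le_iff₀ (hpos z ⟨hz, hle⟩)).1 hquot]

theorem isClosed_setOf_subParallelogram :
    IsClosed {z : ℝ × ℝ × ℝ × ℝ | SubParallelogram z.1 z.2.1 z.2.2.1 z.2.2.2} := by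
  have hiff : ∀ z : ℝ × ℝ × ℝ × ℝ, SubParallelogram z.1 z.2.1 z.2.2.1 z.2.2.2 ↔
      0 ≤ z.1 ∧ 0 ≤ z.2.1 ∧ 0 ≤ z.2.2.1 ∧ 0 ≤ z.2.2.2 ∧ z.2.2.1 ≤ z.1 + z.2.1 ∧
        z.2.2.1 ^ 2 + z.2.2.2 ^ 2 ≤ 2 * z.1 ^ 2 + 2 * z.2.1 ^ 2 := fun z =>
    ⟨fun ⟨ha, hb, hc, hd, hadd, hsq⟩ => ⟨ha, hb, hc, hd, hadd, hsq⟩,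
      fun ⟨ha, hb, hc, hd, hadd, hsq⟩ => ⟨ha, hb, hc, hd, hadd, hsq⟩⟩
  simp only [hiff, ofPred_and]
  refine IsClosed.inter ?_ (IsClosed.inter ?_ (IsClosed.inter ?_ (IsClosed.inter ?_
    (IsClosed.inter ?_ ?_)))) <;> exact isClosed_le (by fun_prop) (by fun_prop)

theorem isCompact_subParallelogram_rpow_add_rpow_eq_one {q : ℝ} (hq : 0 < q) :
    IsCompact {z : ℝ × ℝ × ℝ × ℝ |
      SubParallelogram z.1 z.2.1 z.2.2.1 z.2.2.2 ∧ z.1 ^ q + z.2.1 ^ q = 1} := by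
  have hrpow := Real.continuous_rpow_const hq.le
  have hclosed := isClosed_setOf_subParallelogram.inter
    (isClosed_eq (f := fun z : ℝ × ℝ × ℝ × ℝ => z.1 ^ q + z.2.1 ^ q) (g := fun _ => 1)
      (by fun_prop) continuous_const)
  refine (isCompact_Icc (a := ((0, 0, 0, 0) : ℝ × ℝ × ℝ × ℝ))
    (b := (1, 1, 2, 2))).of_isClosed_subset hclosed ?_
  rintro ⟨a, b, c, d⟩ ⟨h, hone⟩
  obtain ⟨ha, hb, hc, hd, hadd, hsq⟩ : SubParallelogram a b c d := h
  change a ^ q + b ^ q = 1 at hone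
  have haq := Real.rpow_nonneg ha q
  have hbq := Real.rpow_nonneg hb q
  have ha1 : a ≤ 1 := (Real.rpow_le_rpow_iff ha zero_le_one hq).1 (by rw [Real.one_rpow]; linarith)
  have hb1 : b ≤ 1 := (Real.rpow_le_rpow_iff hb zero_le_one hq).1 (by rw [Real.one_rpow]; linarith)
  have hd2 : d ≤ 2 := by nlinarith
  exact ⟨⟨ha, hb, hc, hd⟩, ha1, hb1, by linarith, hd2⟩

theorem exists_forall_subParallelogram_rpow_le {q : ℝ} (hq : 1 < q) {ε : ℝ} (hε : 0 < ε) :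
    ∃ C > 0, ∀ a b c d, SubParallelogram a b c d →
      d ^ q ≤ ε * (a ^ q + b ^ q) + C * ((a ^ q + b ^ q) / 2 - (c / 2) ^ q) := by
  have hq0 : 0 < q := one_pos.trans hq
  have hrpow := Real.continuous_rpow_const hq0.le
  obtain ⟨C, hC, hnormalized⟩ := exists_forall_le_add_mul_of_isCompact
    (isCompact_subParallelogram_rpow_add_rpow_eq_one hq0)
    (f := fun z => z.2.2.2 ^ q) (g := fun z => (z.1 ^ q + z.2.1 ^ q) / 2 - (z.2.2.1 / 2) ^ q)
    (by fun_prop) (by fun_prop) (fun z hz => sub_nonneg.2 (hz.1.half_rpow_le hq.le))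
    (fun z hz h0 => by
      rw [hz.1.eq_zero_of_le_half_rpow hq (sub_eq_zero.1 h0).le, Real.zero_rpow hq0.ne']) hε
  refine ⟨C, hC, fun a b c d h => ?_⟩
  have haq := Real.rpow_nonneg h.nonneg_left q
  have hbq := Real.rpow_nonneg h.nonneg_right q
  rcases (add_nonneg haq hbq).eq_or_lt' with hzero | hpos
  · have hhalf : (c / 2) ^ q = 0 := le_antisymm (by linarith [h.half_rpow_le hq.le])
      (Real.rpow_nonneg (by linarith [h.nonneg_add]) q)
    rw [h.eq_zero_of_le_half_rpow hq (by linarith), Real.zero_rpow hq0.ne', hzero, hhalf]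
    simp
  · set s := (a ^ q + b ^ q) ^ q⁻¹
    have hs : 0 < s := Real.rpow_pos_of_pos hpos _
    have hsq : s ^ q = a ^ q + b ^ q := Real.rpow_inv_rpow hpos.le hq0.ne'
    have hscaled := hnormalized (a / s, b / s, c / s, d / s) ⟨h.div hs, by
      rw [Real.div_rpow h.nonneg_left hs.le, Real.div_rpow h.nonneg_right hs.le, ← add_div, hsq,
        div_self hpos.ne']⟩
    simp only [div_right_comm c s 2] at hscaled
    rw [Real.div_rpow h.nonneg_left hs.le, Real.div_rpow h.nonneg_right hs.le,
      Real.div_rpow h.nonneg_sub hs.le, Real.div_rpow (by linarith [h.nonneg_add]) hs.le, hsq,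
      ← add_div, div_self hpos.ne', div_le_iff₀ hpos] at hscaled
    refine hscaled.trans_eq ?_
    field_simp

end SubParallelogram

section Lp

variable {M : Type*} [MeasurableSpace M] {m : Measure M} {p : ℝ≥0∞} [Fact (1 < p)]
  [Fact (p < ⊤)]

theorem exists_forall_norm_rpow_le_of_ae_subParallelogram {ε : ℝ} (hε : 0 < ε) :
    ∃ C > 0, ∀ a b c d : Lp ℝ p m, (∀ᵐ x ∂m, SubParallelogram (a x) (b x) (c x) (d x)) →
      ‖d‖ ^ p.toReal ≤ ε * (‖a‖ ^ p.toReal + ‖b‖ ^ p.toReal)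
        + C * ((‖a‖ ^ p.toReal + ‖b‖ ^ p.toReal) / 2 - (‖c‖ / 2) ^ p.toReal) := by
  obtain ⟨C, hC, hmain⟩ := exists_forall_subParallelogram_rpow_le (one_lt_toReal (p := p)) hε
  refine ⟨C, hC, fun a b c d h => ?_⟩
  have hsum : Integrable (fun x => ‖a x‖ ^ p.toReal + ‖b x‖ ^ p.toReal) m :=
    (Lp_integrable a).add (Lp_integrable b)
  have hdefect : Integrable (fun x => (‖a x‖ ^ p.toReal + ‖b x‖ ^ p.toReal) / 2
      - ‖c x‖ ^ p.toReal / 2 ^ p.toReal) m :=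
    (hsum.div_const 2).sub ((Lp_integrable c).div_const _)
  rw [Real.div_rpow (norm_nonneg c) two_pos.le]
  simp only [Lp_norm_rpow]
  rw [← integral_add (Lp_integrable a) (Lp_integrable b), ← integral_div, ← integral_div,
    ← integral_sub (hsum.div_const 2) ((Lp_integrable c).div_const _), ← integral_const_mul,
    ← integral_const_mul, ← integral_add (hsum.const_mul ε) (hdefect.const_mul C)]
  refine integral_mono_ae (Lp_integrable d) ((hsum.const_mul ε).add (hdefect.const_mul C)) ?_
  filter_upwards [h] with x hx
  have := hmain (a x) (b x) (c x) (d x) hx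
  rw [Real.div_rpow hx.nonneg_add two_pos.le] at this
  simpa only [Real.norm_of_nonneg hx.nonneg_left, Real.norm_of_nonneg hx.nonneg_right,
    Real.norm_of_nonneg hx.nonneg_add, Real.norm_of_nonneg hx.nonneg_sub] using this

theorem powerUniformlyConvex_of_ae_subParallelogram {X : Type*} [SeminormedAddCommGroup X]
    {ν : X → Lp ℝ p m} (hν : ∀ x, ‖ν x‖ = ‖x‖)
    (h : ∀ x y, ∀ᵐ t ∂m, SubParallelogram (ν x t) (ν y t) (ν (x + y) t) (ν (x - y) t)) :
    PowerUniformlyConvex X p.toReal := fun ε hε => by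
  obtain ⟨C, hC, hmain⟩ := exists_forall_norm_rpow_le_of_ae_subParallelogram (m := m) (p := p) hε
  exact ⟨C, hC, fun x y => by simpa only [hν] using hmain _ _ _ _ (h x y)⟩

variable {E : Type*} [NormedAddCommGroup E] [InnerProductSpace ℝ E]

theorem powerUniformlyConvex_Lp : PowerUniformlyConvex (Lp E p m) p.toReal := by
  refine powerUniformlyConvex_of_ae_subParallelogram (ν := fun f => (Lp.memLp f).norm.toLp _)
    (fun f => ?_) fun f g => ?_
  · rw [Lp.norm_toLp, eLpNorm_norm, Lp.norm_def]
  · filter_upwards [(Lp.memLp f).norm.coeFn_toLp, (Lp.memLp g).norm.coeFn_toLp,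
      (Lp.memLp (f + g)).norm.coeFn_toLp, (Lp.memLp (f - g)).norm.coeFn_toLp, Lp.coeFn_add f g,
      Lp.coeFn_sub f g] with x hf hg hadd hsub hfg_add hfg_sub
    rw [hf, hg, hadd, hsub, hfg_add, hfg_sub]
    exact subParallelogram_norm (f x) (g x)

theorem isReflexiveSpace_Lp [CompleteSpace E] : IsReflexiveSpace (Lp E p m) :=
  have := (powerUniformlyConvex_Lp (E := E) (m := m) (p := p)).uniformConvexSpace
    one_lt_toReal.le
  isReflexiveSpace_of_uniformConvexSpace

end Lp

namespace SublinearFunctional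

variable {M : Type*} [MeasurableSpace M] {m : Measure M} {p : ℝ≥0∞} {F : SublinearFunctional m p}

theorem IsSimple.ae₂ {s t : M → F.domain} (hs : F.IsSimple s) (ht : F.IsSimple t)
    {P : F.domain → F.domain → M → Prop} (h : ∀ f g, ∀ᵐ x ∂m, P f g x) :
    ∀ᵐ x ∂m, P (s x) (t x) x := by
  have hrange : ∀ᵐ x ∂m, ∀ f ∈ range s, P f (t x) x :=
    (ae_ball_iff hs.1).2 fun f _ => ht.ae (P := P f) (h f)
  exact hrange.mono fun x hx => hx _ (mem_range_self x)

variable (hF : ∀ f g : F.domain, ∀ᵐ x ∂m,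
  F.val (f + g) x ^ 2 + F.val (f - g) x ^ 2 ≤ 2 * F.val f x ^ 2 + 2 * F.val g x ^ 2)

include hF

theorem ae_subParallelogram_val (f g : F.domain) :
    ∀ᵐ x ∂m, SubParallelogram (F.val f x) (F.val g x) (F.val (f + g) x) (F.val (f - g) x) := by
  have hnonneg : ∀ f, ∀ᵐ x ∂m, 0 ≤ F.val f x := fun f => (Lp.coeFn_nonneg _).2 (F.val_nonneg f)
  filter_upwards [hnonneg f, hnonneg g, hnonneg (f + g), hnonneg (f - g),
    (Lp.coeFn_le _ _).2 (F.val_add_le f g), Lp.coeFn_add (F.val f) (F.val g), hF f g]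
    with x hf hg hadd hsub hle hcoe hsq
  exact ⟨hf, hg, hadd, hsub, hle.trans_eq hcoe, hsq⟩

variable [Fact (1 < p)] [Fact (p < ⊤)]

theorem powerUniformlyConvex_pfm : PowerUniformlyConvex F.Pfm p.toReal := by
  refine powerUniformlyConvex_of_ae_subParallelogram
    (ν := fun s : F.Pfm => MemLp.toLp (F.pointwiseNorm s) s.2.2) (fun s => Lp.norm_toLp _ _)
    fun s t => ?_
  filter_upwards [s.2.2.coeFn_toLp, t.2.2.coeFn_toLp, (s + t).2.2.coeFn_toLp,
    (s - t).2.2.coeFn_toLp, s.2.1.ae₂ t.2.1 (ae_subParallelogram_val hF)] with x hs ht hadd hsub h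
  rw [hs, ht, hadd, hsub]
  exact h

theorem isReflexiveSpace_generatedModule : IsReflexiveSpace F.GeneratedModule :=
  have := ((powerUniformlyConvex_pfm hF).completion
    ENNReal.toReal_nonneg).uniformConvexSpace one_lt_toReal.le
  isReflexiveSpace_of_uniformConvexSpace

end SublinearFunctional

/-! ### Upper bounds for relaxed slopes -/

section RelaxedUpperSlope

theorem exists_strictMono_ae_tendsto_of_tendsto_Lp {M E : Type*} [MeasurableSpace M]
    [NormedAddCommGroup E] {m : Measure M} {p : ℝ≥0∞} [Fact (1 ≤ p)] {c : ℕ → Lp E p m}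
    {G : Lp E p m} (hc : Tendsto c atTop (𝓝 G)) :
    ∃ φ : ℕ → ℕ, StrictMono φ ∧ ∀ᵐ x ∂m, Tendsto (fun n => c (φ n) x) atTop (𝓝 (G x)) :=
  (tendstoInMeasure_of_tendsto_Lp hc).exists_seq_tendsto_ae

theorem IsTailConvexCombination.ae_le_of_convexOn {M : Type*} [MeasurableSpace M] {m : Measure M}
    {p : ℝ≥0∞} [Fact (1 ≤ p)] {z y : ℕ → Lp ℝ p m × Lp ℝ p m} (h : IsTailConvexCombination z y)
    {Q : ℝ × ℝ → ℝ} (hQ : ConvexOn ℝ univ Q) (hQc : Continuous Q) {b : ℕ → M → ℝ} {B : M → ℝ}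
    (hzb : ∀ n, ∀ᵐ x ∂m, Q ((z n).1 x, (z n).2 x) ≤ b n x)
    (hb : ∀ᵐ x ∂m, Tendsto (fun n => b n x) atTop (𝓝 (B x))) {w : Lp ℝ p m × Lp ℝ p m}
    (hy : Tendsto y atTop (𝓝 w)) : ∀ᵐ x ∂m, Q (w.1 x, w.2 x) ≤ B x := by
  obtain ⟨φ, hφ, hφ_ae⟩ := exists_strictMono_ae_tendsto_of_tendsto_Lp
    ((continuous_fst.tendsto w).comp hy)
  obtain ⟨ψ, hψ, hψ_ae⟩ := exists_strictMono_ae_tendsto_of_tendsto_Lp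
    (((continuous_snd.tendsto w).comp hy).comp hφ.tendsto_atTop)
  filter_upwards [h.ae_coe, ae_all_iff.2 hzb, hb, hφ_ae, hψ_ae] with x hzy hzb hb hfst hsnd
  exact (hzy.comp (hφ.comp hψ)).le_of_convexOn hQ hQc hzb hb
    ((hfst.comp hψ.tendsto_atTop).prodMk_nhds hsnd)

variable {M : Type*} [MetricSpace M] [MeasurableSpace M] [BorelSpace M] {m : Measure M}
  {p : ℝ≥0∞}

theorem convex_setOf_slopeLp_le :
    Convex ℝ {v : lipDomain m p × Lp ℝ p m | slopeLp v.1 ≤ v.2} := by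
  intro v hv w hw s t hs ht _
  calc slopeLp (s • v.1 + t • w.1) ≤ slopeLp (s • v.1) + slopeLp (t • w.1) := slopeLp_add_le _ _
    _ = s • slopeLp v.1 + t • slopeLp w.1 := by
      rw [slopeLp_smul, slopeLp_smul, abs_of_nonneg hs, abs_of_nonneg ht]
    _ ≤ s • v.2 + t • w.2 := add_le_add (Lp_smul_le hs hv) (Lp_smul_le ht hw)

variable [Fact (1 < p)]

/-- `G` is a strong `L^p`-limit of upper bounds for the slopes of functions converging to `f`
almost everywhere. Such `G` dominate `|Df|_{*,p}`, and every weak limit of slopes is of this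
form. -/
def IsRelaxedUpperSlope (f : M → ℝ) (G : Lp ℝ p m) : Prop :=
  ∃ (u : ℕ → lipDomain m p) (c : ℕ → Lp ℝ p m),
    (∀ᵐ x ∂m, Tendsto (fun n => (u n : M → ℝ) x) atTop (𝓝 (f x))) ∧
    (∀ n, slopeLp (u n) ≤ c n) ∧ Tendsto c atTop (𝓝 G)

theorem IsRelaxedUpperSlope.congr_ae {f g : M → ℝ} {G : Lp ℝ p m} (hG : IsRelaxedUpperSlope f G)
    (hfg : f =ᵐ[m] g) : IsRelaxedUpperSlope g G := by
  obtain ⟨u, c, hu, huc, hc⟩ := hG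
  exact ⟨u, c, by filter_upwards [hu, hfg] with x hx hfgx using hfgx ▸ hx, huc, hc⟩

theorem IsRelaxedUpperSlope.exists_ae_tendsto {f : M → ℝ} {G : Lp ℝ p m}
    (hG : IsRelaxedUpperSlope f G) :
    ∃ (u : ℕ → lipDomain m p) (c : ℕ → Lp ℝ p m),
      (∀ᵐ x ∂m, Tendsto (fun n => (u n : M → ℝ) x) atTop (𝓝 (f x))) ∧
      (∀ n, slopeLp (u n) ≤ c n) ∧ Tendsto c atTop (𝓝 G) ∧
      ∀ᵐ x ∂m, Tendsto (fun n => c n x) atTop (𝓝 (G x)) := by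
  obtain ⟨u, c, hu, huc, hc⟩ := hG
  obtain ⟨φ, hφ, hφ_ae⟩ := exists_strictMono_ae_tendsto_of_tendsto_Lp hc
  exact ⟨u ∘ φ, c ∘ φ, hu.mono fun x hx => hx.comp hφ.tendsto_atTop, fun n => huc (φ n),
    hc.comp hφ.tendsto_atTop, hφ_ae⟩

theorem IsTailConvexCombination.isRelaxedUpperSlope {z y : ℕ → lipDomain m p × Lp ℝ p m}
    (h : IsTailConvexCombination z y) {f : M → ℝ} {G : Lp ℝ p m}
    (hf : ∀ᵐ x ∂m, Tendsto (fun n => ((z n).1 : M → ℝ) x) atTop (𝓝 (f x)))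
    (hz : ∀ n, slopeLp (z n).1 ≤ (z n).2) (hG : Tendsto (fun n => (y n).2) atTop (𝓝 G)) :
    IsRelaxedUpperSlope f G := by
  refine ⟨fun n => (y n).1, fun n => (y n).2, ?_,
    fun n => h.mem_of_convex convex_setOf_slopeLp_le fun k _ => hz k, hG⟩
  filter_upwards [hf] with x hx
  exact (h.map ((LinearMap.proj x).comp ((lipDomain m p).subtype.comp
    (LinearMap.fst ℝ (lipDomain m p) (Lp ℝ p m))))).tendsto hx

variable [SigmaFinite m]

theorem isRelaxedUpperSlope_of_mem_weakSlopeLimits {f : M → ℝ} {G : Lp ℝ p m}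
    (hG : G ∈ weakSlopeLimits m p f) : IsRelaxedUpperSlope f G := by
  obtain ⟨u, hu, huG⟩ := hG
  obtain ⟨φ, hφ, hφ_ae⟩ := hu.exists_ae
  obtain ⟨y, hy, hyG⟩ := exists_isTailConvexCombination_tendsto_of_tendsto_dual
    (LinearMap.snd ℝ (lipDomain m p) (Lp ℝ p m)) (fun n => (u (φ n), slopeLp (u (φ n)))) le_rfl
    (fun χ => (huG χ).comp hφ.tendsto_atTop)
  exact hy.isRelaxedUpperSlope hφ_ae (fun _ => le_rfl) hyG

theorem relaxedSlope_le_of_isRelaxedUpperSlope [Fact (p < ⊤)] {f : relaxedDomain m p}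
    {G : Lp ℝ p m} (hG : IsRelaxedUpperSlope (f : M →ₘ[m] ℝ) G) : relaxedSlope f ≤ G := by
  obtain ⟨u, c, hu, huc, hc⟩ := hG
  obtain ⟨B, hB⟩ := hc.norm.bddAbove_range
  obtain ⟨H, hH, hHG⟩ := exists_weakSlopeLimit u c hu huc fun n => hB (mem_range_self n)
  exact ((isGreatest_relaxedSlope f).1 hH).trans (hHG G (TendstoWeakly.of_tendsto hc))

end RelaxedUpperSlope

/-! ### The parallelogram inequality for relaxed slopes -/

section Parallelogram

theorem convexOn_fst_sq_add_snd_sq : ConvexOn ℝ univ fun w : ℝ × ℝ => w.1 ^ 2 + w.2 ^ 2 :=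
  ((even_two.convexOn_pow (𝕜 := ℝ)).comp_linearMap (LinearMap.fst ℝ ℝ ℝ)).add
    ((even_two.convexOn_pow (𝕜 := ℝ)).comp_linearMap (LinearMap.snd ℝ ℝ ℝ))

theorem ae_le_mul_sq_of_isGreatest_lowerBounds {M : Type*} [MeasurableSpace M] {m : Measure M}
    {p : ℝ≥0∞} {S : Set (Lp ℝ p m)} (hS : S.Nonempty) (hS0 : ∀ G ∈ S, 0 ≤ G) {D : Lp ℝ p m}
    (hD : IsGreatest (lowerBounds S) D) {T : M → ℝ} (hT : AEStronglyMeasurable T m) {k : ℝ}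
    (hk : 0 < k) (hTS : ∀ G ∈ S, ∀ᵐ x ∂m, T x ≤ k * G x ^ 2) : ∀ᵐ x ∂m, T x ≤ k * D x ^ 2 := by
  have hsqrt_le : ∀ G ∈ S, ∀ᵐ x ∂m, √(T x / k) ≤ G x := fun G hG => by
    filter_upwards [hTS G hG, (Lp.coeFn_nonneg G).2 (hS0 G hG)] with x hTx hGx
    exact Real.sqrt_le_iff.2 ⟨hGx, (div_le_iff₀' hk).2 hTx⟩
  have hmemLp : MemLp (fun x => √(T x / k)) p m := by
    obtain ⟨G, hG⟩ := hS
    refine (Lp.memLp G).mono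
      ((by fun_prop : Continuous fun t => √(t / k)).comp_aestronglyMeasurable hT) ?_
    filter_upwards [hsqrt_le G hG] with x hx
    rw [Real.norm_of_nonneg (Real.sqrt_nonneg _)]
    exact hx.trans (Real.le_norm_self _)
  have hle : hmemLp.toLp ≤ D := hD.2 fun G hG => by
    rw [← Lp.coeFn_le]
    filter_upwards [hmemLp.coeFn_toLp, hsqrt_le G hG] with x hcoe hx
    rwa [hcoe]
  filter_upwards [hmemLp.coeFn_toLp, (Lp.coeFn_le _ _).2 hle] with x hcoe hx
  rw [hcoe] at hx
  exact (div_le_iff₀' hk).1 ((Real.sqrt_le_left ((Real.sqrt_nonneg _).trans hx)).1 hx)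

variable {M : Type*} [MetricSpace M] [MeasurableSpace M] [BorelSpace M] {m : Measure M}
  {p : ℝ≥0∞}

theorem InfinitesimallyRiemannian.slopeLp_sq_add_sq (hR : InfinitesimallyRiemannian m)
    (u v : lipDomain m p) :
    ∀ᵐ x ∂m, slopeLp (u + v) x ^ 2 + slopeLp (u - v) x ^ 2
      = 2 * slopeLp u x ^ 2 + 2 * slopeLp v x ^ 2 := by
  filter_upwards [hR u v u.2.1 v.2.1, slopeLp_coe u, slopeLp_coe v, slopeLp_coe (u + v),
    slopeLp_coe (u - v)] with x h hu hv hadd hsub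
  rw [hu, hv, hadd, hsub]
  exact h

theorem InfinitesimallyRiemannian.slopeLp_sq_add_sq_le_of_le (hR : InfinitesimallyRiemannian m)
    {u v : lipDomain m p} {c d : Lp ℝ p m} (hc : slopeLp u ≤ c) (hd : slopeLp v ≤ d) :
    ∀ᵐ x ∂m, slopeLp (u + v) x ^ 2 + slopeLp (u - v) x ^ 2 ≤ 2 * c x ^ 2 + 2 * d x ^ 2 := by
  filter_upwards [hR.slopeLp_sq_add_sq u v, (Lp.coeFn_nonneg _).2 (slopeLp_nonneg u),
    (Lp.coeFn_nonneg _).2 (slopeLp_nonneg v), (Lp.coeFn_le _ _).2 hc, (Lp.coeFn_le _ _).2 hd]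
    with x h hu hv hcx hdx
  rw [h]
  gcongr

variable [Fact (1 < p)]

theorem norm_slopeLp_le_norm {u : lipDomain m p} {c : Lp ℝ p m} (hc : slopeLp u ≤ c) :
    ‖slopeLp u‖ ≤ ‖c‖ :=
  norm_le_norm_of_abs_le_abs (by
    rwa [abs_of_nonneg (slopeLp_nonneg u), abs_of_nonneg ((slopeLp_nonneg u).trans hc)])

theorem norm_slopeLp_sub_le (u v : lipDomain m p) :
    ‖slopeLp (u - v)‖ ≤ ‖slopeLp u‖ + ‖slopeLp v‖ := by
  have hneg := norm_slopeLp_smul (-1) v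
  rw [neg_one_smul ℝ v, abs_neg, abs_one, one_mul] at hneg
  rw [sub_eq_add_neg, ← hneg]
  exact norm_slopeLp_add_le u (-v)

variable [Fact (p < ⊤)]

theorem InfinitesimallyRiemannian.exists_isRelaxedUpperSlope_add_sub
    (hR : InfinitesimallyRiemannian m) {f g : M → ℝ} {G H : Lp ℝ p m}
    (hG : IsRelaxedUpperSlope f G) (hH : IsRelaxedUpperSlope g H) :
    ∃ A B : Lp ℝ p m, IsRelaxedUpperSlope (f + g) A ∧ IsRelaxedUpperSlope (f - g) B ∧
      ∀ᵐ x ∂m, A x ^ 2 + B x ^ 2 ≤ 2 * G x ^ 2 + 2 * H x ^ 2 := by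
  obtain ⟨u, c, hu, huc, hc, hc_ae⟩ := hG.exists_ae_tendsto
  obtain ⟨v, d, hv, hvd, hd, hd_ae⟩ := hH.exists_ae_tendsto
  obtain ⟨R, hR_bound⟩ := (hc.norm.add hd.norm).bddAbove_range
  let z : ℕ → (lipDomain m p × Lp ℝ p m) × (lipDomain m p × Lp ℝ p m) := fun n =>
    ((u n + v n, slopeLp (u n + v n)), (u n - v n, slopeLp (u n - v n)))
  let slopes : (lipDomain m p × Lp ℝ p m) × (lipDomain m p × Lp ℝ p m) →ₗ[ℝ]
      Lp ℝ p m × Lp ℝ p m := (LinearMap.snd ℝ _ _).prodMap (LinearMap.snd ℝ _ _)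
  have hbound : ∀ n, ‖slopes (z n)‖ ≤ R := fun n => by
    have hle : ‖slopeLp (u n)‖ + ‖slopeLp (v n)‖ ≤ R :=
      (add_le_add (norm_slopeLp_le_norm (huc n)) (norm_slopeLp_le_norm (hvd n))).trans
        (hR_bound (mem_range_self n))
    exact max_le ((norm_slopeLp_add_le _ _).trans hle) ((norm_slopeLp_sub_le _ _).trans hle)
  obtain ⟨y, ⟨A, B⟩, hzy, hAB⟩ := (isReflexiveSpace_Lp.prod
    isReflexiveSpace_Lp).exists_isTailConvexCombination_tendsto slopes hbound
  refine ⟨A, B, (hzy.map (LinearMap.fst ℝ _ _)).isRelaxedUpperSlope ?_ (fun _ => le_rfl)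
      ((continuous_fst.tendsto _).comp hAB),
    (hzy.map (LinearMap.snd ℝ _ _)).isRelaxedUpperSlope ?_ (fun _ => le_rfl)
      ((continuous_snd.tendsto _).comp hAB), ?_⟩
  · filter_upwards [hu, hv] with x hux hvx using hux.add hvx
  · filter_upwards [hu, hv] with x hux hvx using hux.sub hvx
  · refine (hzy.map slopes).ae_le_of_convexOn convexOn_fst_sq_add_snd_sq (by fun_prop)
      (fun n => hR.slopeLp_sq_add_sq_le_of_le (huc n) (hvd n)) ?_ hAB
    filter_upwards [hc_ae, hd_ae] with x hcx hdx
    exact ((hcx.pow 2).const_mul 2).add ((hdx.pow 2).const_mul 2)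

variable [SigmaFinite m]

theorem InfinitesimallyRiemannian.relaxedSlope_sq_add_sq_le_of_isRelaxedUpperSlope
    (hR : InfinitesimallyRiemannian m) (f g : relaxedDomain m p) {G H : Lp ℝ p m}
    (hG : IsRelaxedUpperSlope (f : M →ₘ[m] ℝ) G) (hH : IsRelaxedUpperSlope (g : M →ₘ[m] ℝ) H) :
    ∀ᵐ x ∂m, relaxedSlope (f + g) x ^ 2 + relaxedSlope (f - g) x ^ 2
      ≤ 2 * G x ^ 2 + 2 * H x ^ 2 := by
  obtain ⟨A, B, hA, hB, hAB⟩ := hR.exists_isRelaxedUpperSlope_add_sub hG hH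
  have hA_le : relaxedSlope (f + g) ≤ A :=
    relaxedSlope_le_of_isRelaxedUpperSlope (hA.congr_ae (AEEqFun.coeFn_add _ _).symm)
  have hB_le : relaxedSlope (f - g) ≤ B :=
    relaxedSlope_le_of_isRelaxedUpperSlope (hB.congr_ae (AEEqFun.coeFn_sub _ _).symm)
  filter_upwards [hAB, (Lp.coeFn_le _ _).2 hA_le, (Lp.coeFn_le _ _).2 hB_le,
    (Lp.coeFn_nonneg _).2 (relaxedSlope_nonneg (f + g)),
    (Lp.coeFn_nonneg _).2 (relaxedSlope_nonneg (f - g))] with x h hAx hBx hadd hsub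
  exact (add_le_add (pow_le_pow_left₀ hadd hAx 2) (pow_le_pow_left₀ hsub hBx 2)).trans h

theorem InfinitesimallyRiemannian.relaxedSlope_sq_add_sq_le (hR : InfinitesimallyRiemannian m)
    (f g : relaxedDomain m p) :
    ∀ᵐ x ∂m, relaxedSlope (f + g) x ^ 2 + relaxedSlope (f - g) x ^ 2
      ≤ 2 * relaxedSlope f x ^ 2 + 2 * relaxedSlope g x ^ 2 := by
  set S : M → ℝ := fun x => relaxedSlope (f + g) x ^ 2 + relaxedSlope (f - g) x ^ 2
  have hS : AEStronglyMeasurable S m :=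
    ((Lp.aestronglyMeasurable _).pow 2).add ((Lp.aestronglyMeasurable _).pow 2)
  have hS_sub : ∀ G : Lp ℝ p m, AEStronglyMeasurable (fun x => S x - 2 * G x ^ 2) m := fun G =>
    hS.sub (((Lp.aestronglyMeasurable G).pow 2).const_mul 2)
  have hf : ∀ H ∈ weakSlopeLimits m p g,
      ∀ᵐ x ∂m, S x - 2 * H x ^ 2 ≤ 2 * relaxedSlope f x ^ 2 := fun H hH => by
    refine ae_le_mul_sq_of_isGreatest_lowerBounds (weakSlopeLimits_nonempty f.2)
      weakSlopeLimits_nonneg (isGreatest_relaxedSlope f) (hS_sub H) two_pos fun G hG => ?_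
    filter_upwards [hR.relaxedSlope_sq_add_sq_le_of_isRelaxedUpperSlope f g
      (isRelaxedUpperSlope_of_mem_weakSlopeLimits hG)
      (isRelaxedUpperSlope_of_mem_weakSlopeLimits hH)] with x hx using sub_le_iff_le_add.2 hx
  have hg : ∀ᵐ x ∂m, S x - 2 * relaxedSlope f x ^ 2 ≤ 2 * relaxedSlope g x ^ 2 :=
    ae_le_mul_sq_of_isGreatest_lowerBounds (weakSlopeLimits_nonempty g.2)
      weakSlopeLimits_nonneg (isGreatest_relaxedSlope g) (hS_sub _) two_pos fun H hH => by
        filter_upwards [hf H hH] with x hx using sub_le_comm.1 hx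
  filter_upwards [hg] with x hx using sub_le_iff_le_add'.1 hx

end Parallelogram

/-! ### The Cheeger energy -/

section Cheeger

theorem isQuadraticForm_of_add_le {V : Type*} [AddCommGroup V] [Module ℝ V] {E : V → ℝ≥0∞}
    (hE : ∀ f g, E (f + g) + E (f - g) ≤ 2 * E f + 2 * E g)
    (hsmul : ∀ (c : ℝ) (f), E (c • f) = ENNReal.ofReal (c ^ 2) * E f) : IsQuadraticForm E := by
  refine ⟨fun f g => (hE f g).antisymm ?_, hsmul⟩
  have htwo : ∀ f, E (f + f) = 2 * (2 * E f) := fun f => by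
    rw [← two_smul ℝ f, hsmul, sq, ENNReal.ofReal_mul zero_le_two, ENNReal.ofReal_ofNat, mul_assoc]
  have hdual := hE (f + g) (f - g)
  rw [add_add_sub_cancel, add_sub_sub_cancel, htwo, htwo, ← mul_add 2 (2 * E f),
    ← mul_add 2 (E (f + g))] at hdual
  exact (ENNReal.mul_le_mul_iff_right two_ne_zero ENNReal.ofNat_ne_top).1 hdual

variable {M : Type*} [MetricSpace M] [MeasurableSpace M] [BorelSpace M]
  {m : Measure M} [SigmaFinite m]

theorem cheegerEnergy_coe (f : relaxedDomain m 2) :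
    cheegerEnergy m f = ∫⁻ x, ENNReal.ofReal (relaxedSlope f x ^ 2) ∂m := by
  rw [cheegerEnergy, dif_pos f.2]
  refine lintegral_congr_ae ?_
  filter_upwards [(Lp.coeFn_nonneg _).2 (relaxedSlope_nonneg f)] with x hx
  rw [ENNReal.ofReal_pow hx]

theorem cheegerEnergy_of_notMem {f : M →ₘ[m] ℝ} (hf : f ∉ relaxedDomain m 2) :
    cheegerEnergy m f = ⊤ := dif_neg hf

theorem cheegerEnergy_smul_coe (c : ℝ) (f : relaxedDomain m 2) :
    cheegerEnergy m (c • (f : M →ₘ[m] ℝ)) = ENNReal.ofReal (c ^ 2) * cheegerEnergy m f := by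
  rw [← Submodule.coe_smul, cheegerEnergy_coe, cheegerEnergy_coe,
    ← lintegral_const_mul' _ _ ENNReal.ofReal_ne_top, relaxedSlope_smul]
  refine lintegral_congr_ae ?_
  filter_upwards [Lp.coeFn_smul |c| (relaxedSlope f)] with x hx
  rw [hx, Pi.smul_apply, smul_eq_mul, mul_pow, sq_abs, ENNReal.ofReal_mul (sq_nonneg c)]

theorem cheegerEnergy_smul (c : ℝ) (f : M →ₘ[m] ℝ) :
    cheegerEnergy m (c • f) = ENNReal.ofReal (c ^ 2) * cheegerEnergy m f := by
  rcases eq_or_ne c 0 with rfl | hc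
  · have hzero := cheegerEnergy_smul_coe 0 (0 : relaxedDomain m 2)
    rw [zero_smul] at hzero ⊢
    simp only [hzero, ne_eq, OfNat.ofNat_ne_zero, not_false_eq_true, zero_pow,
      ENNReal.ofReal_zero, zero_mul]
  by_cases hf : f ∈ relaxedDomain m 2
  · exact cheegerEnergy_smul_coe c ⟨f, hf⟩
  · have hcf : c • f ∉ relaxedDomain m 2 := mt (Submodule.smul_mem_iff _ hc).1 hf
    rw [cheegerEnergy_of_notMem hf, cheegerEnergy_of_notMem hcf,
      ENNReal.mul_top (ENNReal.ofReal_pos.2 (sq_pos_of_ne_zero hc)).ne']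

variable (hR : InfinitesimallyRiemannian m)

include hR

theorem InfinitesimallyRiemannian.cheegerEnergy_add_sub_le_coe (f g : relaxedDomain m 2) :
    cheegerEnergy m (f + g : M →ₘ[m] ℝ) + cheegerEnergy m (f - g : M →ₘ[m] ℝ)
      ≤ 2 * cheegerEnergy m f + 2 * cheegerEnergy m g := by
  have hmeas : ∀ h : relaxedDomain m 2,
      AEMeasurable (fun x => ENNReal.ofReal (relaxedSlope h x ^ 2)) m := fun h =>
    ((Lp.aestronglyMeasurable _).aemeasurable.pow_const 2).ennreal_ofReal
  rw [← Submodule.coe_add, ← Submodule.coe_sub]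
  simp only [cheegerEnergy_coe]
  rw [← lintegral_add_left' (hmeas _), ← lintegral_const_mul' _ _ ENNReal.ofNat_ne_top,
    ← lintegral_const_mul' _ _ ENNReal.ofNat_ne_top,
    ← lintegral_add_left' ((hmeas _).const_mul 2)]
  refine lintegral_mono_ae ?_
  filter_upwards [hR.relaxedSlope_sq_add_sq_le f g] with x hx
  have htwo_mul : ∀ t : ℝ, 2 * ENNReal.ofReal t = ENNReal.ofReal (2 * t) := fun t => by
    rw [ENNReal.ofReal_mul zero_le_two, ENNReal.ofReal_ofNat]
  rw [← ENNReal.ofReal_add (sq_nonneg _) (sq_nonneg _), htwo_mul, htwo_mul,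
    ← ENNReal.ofReal_add (by positivity) (by positivity)]
  exact ENNReal.ofReal_le_ofReal hx

theorem InfinitesimallyRiemannian.cheegerEnergy_add_sub_le (f g : M →ₘ[m] ℝ) :
    cheegerEnergy m (f + g) + cheegerEnergy m (f - g)
      ≤ 2 * cheegerEnergy m f + 2 * cheegerEnergy m g := by
  by_cases hf : f ∈ relaxedDomain m 2
  · by_cases hg : g ∈ relaxedDomain m 2
    · exact hR.cheegerEnergy_add_sub_le_coe ⟨f, hf⟩ ⟨g, hg⟩
    · simp [cheegerEnergy_of_notMem hg]
  · simp [cheegerEnergy_of_notMem hf]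

theorem InfinitesimallyRiemannian.infinitesimallyHilbertian : InfinitesimallyHilbertian m :=
  isQuadraticForm_of_add_le hR.cheegerEnergy_add_sub_le cheegerEnergy_smul

end Cheeger

end MetricSobolev

theorem mainTheorem10_general {M : Type*} [MetricSpace M] [MeasurableSpace M] [BorelSpace M]
    (m : Measure M) [SigmaFinite m] (hR : MetricSobolev.InfinitesimallyRiemannian m) :
    MetricSobolev.InfinitesimallyHilbertian m ∧
      ∀ (p : ℝ≥0∞) [Fact (1 < p)] [Fact (p < ⊤)],
        MetricSobolev.IsReflexiveSpace (MetricSobolev.CotangentModule m p) :=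
  ⟨hR.infinitesimallyHilbertian, fun _ _ _ =>
    MetricSobolev.SublinearFunctional.isReflexiveSpace_generatedModule
      hR.relaxedSlope_sq_add_sq_le⟩

theorem mainTheorem10 {M : Type*} [MetricSpace M] [CompleteSpace M] [MeasurableSpace M]
    [BorelSpace M] (m : Measure M) [m.Regular] [MetricSobolev.FiniteOnBounded m]
    (hR : MetricSobolev.InfinitesimallyRiemannian m) :
    MetricSobolev.InfinitesimallyHilbertian m ∧
      ∀ (p : ℝ≥0∞) [Fact (1 < p)] [Fact (p < ⊤)],
        MetricSobolev.IsReflexiveSpace (MetricSobolev.CotangentModule m p) :=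
  mainTheorem10_general m hR
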